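/- Let ${\bf k}$ be a field of prime characteristic $p$, let $G$ be a group with a finite normal subgroup $H$ such that $p\nmid |H|$ and $G/H\cong C_q$ is cyclic of order $q$, where $q$ is a power of $p$, and let $\rho$ be a generator of $C_q=G/H$; put $\Delta_\rho=1-\rho$, acting on the $H$-invariants of any ${\bf k}G$-module. Let $A$ be a unital ${\bf k}$-algebra on which $G$ acts by ${\bf k}$-algebra automorphisms, and let $M$ be an $A^eG$-module algebra, i.e. an $A$-bimodule (with ${\bf k}$ acting centrally) that is also a unital ${\bf k}$-algebra, such that the multiplication of $M$ is an $A$-bimodule map $M\otimes_A M\to M$, and $G$ acts on $M$ by ${\bf k}$-algebra automorphisms with ${}^{\alpha}(axb)={}^{\alpha}a\,{}^{\alpha}x\,{}^{\alpha}b$ for $\alpha\in G$, $a,b\in A$, $x\in M$. Let $C(A,M)$ be the Hochschild cochain complex, $C^n(A,M)={\rm Hom}_{\bf k}(A^{\otimes n},M)$, with the cup product $\smile$ and the $G$-action $({}^{\alpha}f)(x)=\alpha\big(f(\alpha^{-1}x)\big)$. Let ${\rm HH}^*(A,M)$ be its cohomology, with the induced $G$-action and product, let ${\rm HH}^*(A,M)^{G\uparrow}$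 be the cohomology of the subcomplex $C(A,M)^G$, and let $\Theta_M^G:{\rm HH}^*(A,M)^{G\uparrow}\to {\rm HH}^*(A,M)^G$ be the homomorphism of graded algebras induced by the inclusion $C(A,M)^G\subset C(A,M)$. Put $$\mathcal A_M^G={\rm Im}\,\Theta_M^G,\qquad X_M^G={\rm Ker}\,\Theta_M^G,\qquad Y_M^G={\rm HH}^*(A,M)^G/{\rm Im}\,\Theta_M^G .$$ Assume that $M$ is $({\bf m},{\bf h})$-degenerated: ${\bf m}\in M^H$ and ${\bf h}\in{\rm Der}(A,M)^H$ satisfy $\Delta_\rho^{q-1}{\bf m}=1_M$ and $\Delta_\rho{\bf h}+\phi_{\bf m}=0$, where $\phi_{\bf m}(a)=a{\bf m}-{\bf m}a$ for $a\in A$. Then the product of any two elements of the ideal $X_M^G$ of ${\rm HH}^*(A,M)^{G\uparrow}$ is zero, so that $X_M^G$ is a graded $\mathcal A_M^G$-bimodule by $\Theta_M^G(b)x=b\smile x$ and $x\,\Theta_M^G(b)=x\smile b$; also $Y_M^G$ is a graded $\mathcal A_M^G$-bimodule by the product of ${\rm HH}^*(A,M)^G$. There are two filtrations by graded $\mathcal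 A_M^G$-subbimodules $$0=X_{q-1}\subset X_{q-2}\subset\cdots\subset X_1\subset X_0=X_M^G,\qquad 0=Y_{q-1}\subset Y_{q-2}\subset\cdots\subset Y_1\subset Y_0=Y_M^G$$ (inclusions not necessarily strict) such that $Y_i/Y_{i+1}\cong X_{q-2-i}/X_{q-1-i}$ as graded $\mathcal A_M^G$-bimodules for $0\le i\le q-2$. Moreover, if $\Delta_\rho^i\,{\rm HH}^*(A,M)^H={\rm HH}^*(A,M)^G$ for some $0\le i\le q-1$, then $X_{q-1-i}=0=Y_{i+1}$, $X_{q-2-i}=X_M^G$, $Y_i=Y_M^G$, and $X_M^G\cong Y_M^G$ as graded $\mathcal A_M^G$-bimodules (for $i=q-1$ one reads $X_{-1}=X_M^G$ and $Y_q=0$). -/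

import Mathlib

/-!  Hochschild cohomology with a group action: cochains, differential, cup product, the
invariant subcomplex, the comparison map `Θ`, and graded bimodules. -/

namespace HochG

open MulOpposite

/-- `M` is an `A^eG`-module algebra.  The type class arguments say that `A` and `M` are unital
`k`-algebras on which `G` acts by `k`-algebra automorphisms and that `M` is an `A`-bimodule (the right
action of `a` is `op a • x`).  The fields say that the multiplication of `M` is an `A`-bimodule map
`M ⊗_A M → M`, and that `G` acts compatibly on `A` and on the bimodule `M`. -/
class IsAeGModuleAlgebra (k A M G : Type*) [Field k] [Ring A] [Algebra k A] [Ring M] [Algebra k M]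
    [Module A M] [Module Aᵐᵒᵖ M] [SMulCommClass A Aᵐᵒᵖ M]
    [IsScalarTower k A M] [IsScalarTower k Aᵐᵒᵖ M]
    [Group G] [MulSemiringAction G A] [SMulCommClass G k A]
    [MulSemiringAction G M] [SMulCommClass G k M] : Prop where
  smul_mul : ∀ (a : A) (x y : M), (a • x) * y = a • (x * y)
  mul_op_smul : ∀ (a : A) (x y : M), x * (op a • y) = op a • (x * y)
  op_smul_mul : ∀ (a : A) (x y : M), (op a • x) * y = x * (a • y)
  group_smul : ∀ (g : G) (a : A) (x : M), g • (a • x) = (g • a) • (g • x)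
  group_op_smul : ∀ (g : G) (a : A) (x : M), g • (op a • x) = op (g • a) • (g • x)

/-! ### Subquotients of modules -/

section Subquot

variable {k : Type*} [Field k]

/-- The quotient `P / (P' ∩ P)`; it is only used for `P' ≤ P`, where it is `P / P'`. -/
def Subquot {V : Type*} [AddCommGroup V] [Module k V] (P P' : Submodule k V) : Type _ :=
  P ⧸ P'.submoduleOf P

instance {V : Type*} [AddCommGroup V] [Module k V] (P P' : Submodule k V) :
    AddCommGroup (Subquot P P') :=
  inferInstanceAs (AddCommGroup (P ⧸ P'.submoduleOf P))

instance {V : Type*} [AddCommGroup V] [Module k V] (P P' : Submodule k V) :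
    Module k (Subquot P P') :=
  inferInstanceAs (Module k (P ⧸ P'.submoduleOf P))

/-- The class of an element of `P`. -/
def Subquot.mk {V : Type*} [AddCommGroup V] [Module k V] (P P' : Submodule k V) :
    P →ₗ[k] Subquot P P' := (P'.submoduleOf P).mkQ

/-- A linear map of subquotients induced by a linear map. -/
def Subquot.map {V W : Type*} [AddCommGroup V] [Module k V] [AddCommGroup W] [Module k W]
    (φ : V →ₗ[k] W) (P P' : Submodule k V) (Q Q' : Submodule k W)
    (h : ∀ v ∈ P, φ v ∈ Q) (h' : ∀ v ∈ P, v ∈ P' → φ v ∈ Q') :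
    Subquot P P' →ₗ[k] Subquot Q Q' :=
  Submodule.mapQ (P'.submoduleOf P) (Q'.submoduleOf Q) (φ.restrict h) (fun v hv => h' v.1 v.2 hv)

theorem Subquot.mk_surjective {V : Type*} [AddCommGroup V] [Module k V] (P P' : Submodule k V) :
    Function.Surjective (Subquot.mk P P') := Submodule.mkQ_surjective _

theorem Subquot.mk_eq_zero {V : Type*} [AddCommGroup V] [Module k V] {P P' : Submodule k V}
    (v : P) : Subquot.mk P P' v = 0 ↔ (v : V) ∈ P' := Submodule.Quotient.mk_eq_zero _

theorem Subquot.map_mk {V W : Type*} [AddCommGroup V] [Module k V] [AddCommGroup W] [Module k W]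
    (φ : V →ₗ[k] W) (P P' : Submodule k V) (Q Q' : Submodule k W)
    (h : ∀ v ∈ P, φ v ∈ Q) (h' : ∀ v ∈ P, v ∈ P' → φ v ∈ Q') (v : P) :
    Subquot.map φ P P' Q Q' h h' (Subquot.mk P P' v) = Subquot.mk Q Q' ⟨φ v, h v v.2⟩ := rfl

/-- A bilinear map `U × (Q / Q') → T / T'` induced by a bilinear map. -/
def Subquot.mapRight {U V W : Type*} [AddCommGroup U] [Module k U] [AddCommGroup V] [Module k V]
    [AddCommGroup W] [Module k W] (β : U →ₗ[k] V →ₗ[k] W)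
    (Q Q' : Submodule k V) (T T' : Submodule k W)
    (h : ∀ u, ∀ v ∈ Q, β u v ∈ T) (h' : ∀ u, ∀ v ∈ Q, v ∈ Q' → β u v ∈ T') :
    U →ₗ[k] Subquot Q Q' →ₗ[k] Subquot T T' where
  toFun u := Subquot.map (β u) Q Q' T T' (h u) (h' u)
  map_add' u u' := by
    refine LinearMap.ext fun x => ?_
    obtain ⟨v, rfl⟩ := Subquot.mk_surjective _ _ x
    rw [LinearMap.add_apply, Subquot.map_mk, Subquot.map_mk, Subquot.map_mk, ← map_add]
    congr 1
    ext
    simp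
  map_smul' c u := by
    refine LinearMap.ext fun x => ?_
    obtain ⟨v, rfl⟩ := Subquot.mk_surjective _ _ x
    rw [RingHom.id_apply, LinearMap.smul_apply, Subquot.map_mk, Subquot.map_mk, ← map_smul]
    congr 1
    ext
    simp

/-- A bilinear map `(P / P') × (Q / Q') → T / T'` induced by a bilinear map. -/
def Subquot.map₂ {U V W : Type*} [AddCommGroup U] [Module k U] [AddCommGroup V] [Module k V]
    [AddCommGroup W] [Module k W] (β : U →ₗ[k] V →ₗ[k] W)
    (P P' : Submodule k U) (Q Q' : Submodule k V) (T T' : Submodule k W)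
    (h : ∀ u ∈ P, ∀ v ∈ Q, β u v ∈ T)
    (hl : ∀ u ∈ P, u ∈ P' → ∀ v ∈ Q, β u v ∈ T')
    (hr : ∀ u ∈ P, ∀ v ∈ Q, v ∈ Q' → β u v ∈ T') :
    Subquot P P' →ₗ[k] Subquot Q Q' →ₗ[k] Subquot T T' :=
  (P'.submoduleOf P).liftQ
    (Subquot.mapRight (β.comp P.subtype) Q Q' T T' (fun u => h u.1 u.2) (fun u => hr u.1 u.2))
    (by
      intro u hu
      rw [LinearMap.mem_ker]
      refine LinearMap.ext fun x => ?_
      obtain ⟨v, rfl⟩ := Subquot.mk_surjective _ _ x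
      exact (Subquot.mk_eq_zero _).2 (hl u.1 u.2 hu v.1 v.2))

theorem Subquot.map₂_mk {U V W : Type*} [AddCommGroup U] [Module k U] [AddCommGroup V] [Module k V]
    [AddCommGroup W] [Module k W] (β : U →ₗ[k] V →ₗ[k] W)
    (P P' : Submodule k U) (Q Q' : Submodule k V) (T T' : Submodule k W)
    (h : ∀ u ∈ P, ∀ v ∈ Q, β u v ∈ T)
    (hl : ∀ u ∈ P, u ∈ P' → ∀ v ∈ Q, β u v ∈ T')
    (hr : ∀ u ∈ P, ∀ v ∈ Q, v ∈ Q' → β u v ∈ T') (u : P) (v : Q) :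
    Subquot.map₂ β P P' Q Q' T T' h hl hr (Subquot.mk P P' u) (Subquot.mk Q Q' v) =
      Subquot.mk T T' ⟨β u v, h u u.2 v v.2⟩ := rfl

end Subquot

/-! ### Cochains -/

section Cochains

variable (k A M : Type*) [Field k] [Ring A] [Algebra k A] [Ring M] [Algebra k M]

/-- `C^n(A, M) = Hom_k(A^{⊗ n}, M)`. -/
abbrev Cochain (n : ℕ) : Type _ := MultilinearMap k (fun _ : Fin n => A) M

variable {k A M}

theorem contractNth_update {n : ℕ} (i : Fin n) (a : Fin (n + 1) → A) (j : Fin (n + 1)) :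
    ∃ (l : Fin n) (φ : A →ₗ[k] A), ∀ x, Fin.contractNth i.castSucc (· * ·) (Function.update a j x) =
      Function.update (Fin.contractNth i.castSucc (· * ·) a) l (φ x) := by
  have key : ∀ (l : Fin n) (φ : A →ₗ[k] A),
      (∀ x, Fin.contractNth i.castSucc (· * ·) (Function.update a j x) l = φ x) →
      (∀ l', l' ≠ l → ∀ x, Fin.contractNth i.castSucc (· * ·) (Function.update a j x) l' =
        Fin.contractNth i.castSucc (· * ·) a l') →
      ∀ x, Fin.contractNth i.castSucc (· * ·) (Function.update a j x) =
      Function.update (Fin.contractNth i.castSucc (· * ·) a) l (φ x) := by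
    intro l φ h1 h2 x
    funext l'
    by_cases h : l' = l
    · subst h; simp [h1]
    · simp [h, h2 l' h]
  rcases lt_trichotomy j.val i.val with hj | hj | hj
  · refine ⟨⟨j.val, by omega⟩, LinearMap.id, key _ _ ?_ ?_⟩
    · intro x
      have : (Fin.castSucc ⟨j.val, by omega⟩ : Fin (n + 1)) = j := by ext; simp
      simp [Fin.contractNth, hj, this]
    · intro l' hl' x
      simp only [Fin.contractNth, Function.update_apply, Fin.ext_iff, Fin.val_castSucc,
        Fin.val_succ, ne_eq] at *
      split_ifs <;> first | rfl | omega
  · refine ⟨i, LinearMap.mulRight k (a i.succ), key _ _ ?_ ?_⟩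
    · intro x
      simp only [Fin.contractNth, Function.update_apply, Fin.ext_iff, Fin.val_castSucc,
        Fin.val_succ, LinearMap.mulRight_apply]
      split_ifs <;> first | rfl | omega
    · intro l' hl' x
      simp only [Fin.contractNth, Function.update_apply, Fin.ext_iff, Fin.val_castSucc,
        Fin.val_succ, ne_eq] at *
      split_ifs <;> first | rfl | omega
  · by_cases hj' : j.val = i.val + 1
    · refine ⟨i, LinearMap.mulLeft k (a i.castSucc), key _ _ ?_ ?_⟩
      · intro x
        simp only [Fin.contractNth, Function.update_apply, Fin.ext_iff, Fin.val_castSucc,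
          Fin.val_succ, LinearMap.mulLeft_apply]
        split_ifs <;> first | rfl | omega
      · intro l' hl' x
        simp only [Fin.contractNth, Function.update_apply, Fin.ext_iff, Fin.val_castSucc,
          Fin.val_succ, ne_eq] at *
        split_ifs <;> first | rfl | omega
    · refine ⟨⟨j.val - 1, by omega⟩, LinearMap.id, key _ _ ?_ ?_⟩
      · intro x
        simp only [Fin.contractNth, Function.update_apply, Fin.ext_iff, Fin.val_castSucc,
          Fin.val_succ, LinearMap.id_apply]
        split_ifs <;> first | rfl | omega
      · intro l' hl' x
        simp only [Fin.contractNth, Function.update_apply, Fin.ext_iff, Fin.val_castSucc,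
          Fin.val_succ, ne_eq] at *
        split_ifs <;> first | rfl | omega

/-- The cochain `a ↦ f (a₀, …, a_i a_{i+1}, …, a_n)` (indices start at `0`). -/
def contractTerm {n : ℕ} (i : Fin n) : Cochain k A M n →ₗ[k] Cochain k A M (n + 1) where
  toFun f :=
    { toFun := fun a => f (Fin.contractNth i.castSucc (· * ·) a)
      map_update_add' := by
        intro inst a j x y
        obtain rfl : inst = instDecidableEqFin _ := Subsingleton.elim _ _
        obtain ⟨l, φ, h⟩ := contractNth_update (k := k) i a j
        simp [h]
      map_update_smul' := by
        intro inst a j c x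
        obtain rfl : inst = instDecidableEqFin _ := Subsingleton.elim _ _
        obtain ⟨l, φ, h⟩ := contractNth_update (k := k) i a j
        simp [h] }
  map_add' _ _ := rfl
  map_smul' _ _ := rfl

section Bimodule

variable [Module A M] [Module Aᵐᵒᵖ M] [IsScalarTower k A M] [IsScalarTower k Aᵐᵒᵖ M]

/-- The cochain `a ↦ a₀ f (a₁, …, a_n)`. -/
def leftTerm (n : ℕ) : Cochain k A M n →ₗ[k] Cochain k A M (n + 1) where
  toFun f :=
    { toFun := fun a => a 0 • f (fun i => a i.succ)
      map_update_add' := by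
        intro inst a j x y
        obtain rfl : inst = instDecidableEqFin _ := Subsingleton.elim _ _
        refine Fin.cases ?_ (fun j => ?_) j
        · simp [add_smul]
        · have h : ∀ z, (fun i : Fin n => Function.update a j.succ z i.succ) =
              Function.update (fun i : Fin n => a i.succ) j z := by
            intro z; funext i; simp [Function.update_apply]
          have h0 : ∀ z, Function.update a j.succ z 0 = a 0 := fun z =>
            Function.update_of_ne (Fin.succ_ne_zero j).symm _ _
          simp [h, h0, smul_add]
      map_update_smul' := by
        intro inst a j c x
        obtain rfl : inst = instDecidableEqFin _ := Subsingleton.elim _ _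
        refine Fin.cases ?_ (fun j => ?_) j
        · simp
        · have h : ∀ z, (fun i : Fin n => Function.update a j.succ z i.succ) =
              Function.update (fun i : Fin n => a i.succ) j z := by
            intro z; funext i; simp [Function.update_apply]
          have h0 : ∀ z, Function.update a j.succ z 0 = a 0 := fun z =>
            Function.update_of_ne (Fin.succ_ne_zero j).symm _ _
          simp [h, h0, smul_comm c (a 0)] }
  map_add' f g := by ext a; simp
  map_smul' c f := by ext a; simp [smul_comm c (a 0)]

/-- The cochain `a ↦ f (a₀, …, a_{n-1}) a_n`. -/
def rightTerm (n : ℕ) : Cochain k A M n →ₗ[k] Cochain k A M (n + 1) where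
  toFun f :=
    { toFun := fun a => op (a (Fin.last n)) • f (fun i => a i.castSucc)
      map_update_add' := by
        intro inst a j x y
        obtain rfl : inst = instDecidableEqFin _ := Subsingleton.elim _ _
        refine Fin.lastCases ?_ (fun j => ?_) j
        · simp [add_smul]
        · have h : ∀ z, (fun i : Fin n => Function.update a j.castSucc z i.castSucc) =
              Function.update (fun i : Fin n => a i.castSucc) j z := by
            intro z; funext i; simp [Function.update_apply]
          have h0 : ∀ z, Function.update a j.castSucc z (Fin.last n) = a (Fin.last n) := fun z =>
            Function.update_of_ne (Fin.castSucc_ne_last j).symm _ _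
          simp [h, h0, smul_add]
      map_update_smul' := by
        intro inst a j c x
        obtain rfl : inst = instDecidableEqFin _ := Subsingleton.elim _ _
        refine Fin.lastCases ?_ (fun j => ?_) j
        · simp
        · have h : ∀ z, (fun i : Fin n => Function.update a j.castSucc z i.castSucc) =
              Function.update (fun i : Fin n => a i.castSucc) j z := by
            intro z; funext i; simp [Function.update_apply]
          have h0 : ∀ z, Function.update a j.castSucc z (Fin.last n) = a (Fin.last n) := fun z =>
            Function.update_of_ne (Fin.castSucc_ne_last j).symm _ _
          simp [h, h0, smul_comm c (op (a (Fin.last n)))] }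
  map_add' f g := by ext a; simp
  map_smul' c f := by ext a; simp [smul_comm c (op (a (Fin.last n)))]

/-- The Hochschild differential `δ^n : C^n(A, M) → C^{n+1}(A, M)`. -/
def d (n : ℕ) : Cochain k A M n →ₗ[k] Cochain k A M (n + 1) :=
  leftTerm n + ∑ i : Fin n, ((-1 : k) ^ (i.val + 1)) • contractTerm i +
    ((-1 : k) ^ (n + 1)) • rightTerm n

theorem d_apply (n : ℕ) (f : Cochain k A M n) (a : Fin (n + 1) → A) :
    d n f a = a 0 • f (fun i => a i.succ) +
      ∑ i : Fin n, ((-1 : k) ^ (i.val + 1)) • f (Fin.contractNth i.castSucc (· * ·) a) +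
      ((-1 : k) ^ (n + 1)) • (op (a (Fin.last n)) • f (fun i => a i.castSucc)) := by
  simp [d, leftTerm, rightTerm, contractTerm, sum_apply]

end Bimodule

/-- The cup product `(f ⌣ g)(a₁, …, a_{n+m}) = f (a₁, …, a_n) g (a_{n+1}, …, a_{n+m})`. -/
def cup (n m : ℕ) : Cochain k A M n →ₗ[k] Cochain k A M m →ₗ[k] Cochain k A M (n + m) :=
  LinearMap.mk₂ k
    (fun f g =>
      { toFun := fun a => f (fun i => a (Fin.castAdd m i)) * g (fun i => a (Fin.natAdd n i))
        map_update_add' := by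
          intro inst a j x y
          obtain rfl : inst = instDecidableEqFin _ := Subsingleton.elim _ _
          refine Fin.addCases (fun j => ?_) (fun j => ?_) j
          · have h1 : ∀ z, (fun i : Fin n => Function.update a (Fin.castAdd m j) z (Fin.castAdd m i)) =
                Function.update (fun i : Fin n => a (Fin.castAdd m i)) j z := by
              intro z; funext i; simp [Function.update_apply]
            have h2 : ∀ z, (fun i : Fin m => Function.update a (Fin.castAdd m j) z (Fin.natAdd n i)) =
                (fun i : Fin m => a (Fin.natAdd n i)) := by
              intro z; funext i
              apply Function.update_of_ne
              simp only [ne_eq, Fin.ext_iff, Fin.val_natAdd, Fin.val_castAdd]; omega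
            simp only [h1, h2, f.map_update_add, add_mul]
          · have h1 : ∀ z, (fun i : Fin m => Function.update a (Fin.natAdd n j) z (Fin.natAdd n i)) =
                Function.update (fun i : Fin m => a (Fin.natAdd n i)) j z := by
              intro z; funext i; simp [Function.update_apply]
            have h2 : ∀ z, (fun i : Fin n => Function.update a (Fin.natAdd n j) z (Fin.castAdd m i)) =
                (fun i : Fin n => a (Fin.castAdd m i)) := by
              intro z; funext i
              apply Function.update_of_ne
              simp only [ne_eq, Fin.ext_iff, Fin.val_natAdd, Fin.val_castAdd]; omega
            simp only [h1, h2, g.map_update_add, mul_add]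
        map_update_smul' := by
          intro inst a j c x
          obtain rfl : inst = instDecidableEqFin _ := Subsingleton.elim _ _
          refine Fin.addCases (fun j => ?_) (fun j => ?_) j
          · have h1 : ∀ z, (fun i : Fin n => Function.update a (Fin.castAdd m j) z (Fin.castAdd m i)) =
                Function.update (fun i : Fin n => a (Fin.castAdd m i)) j z := by
              intro z; funext i; simp [Function.update_apply]
            have h2 : ∀ z, (fun i : Fin m => Function.update a (Fin.castAdd m j) z (Fin.natAdd n i)) =
                (fun i : Fin m => a (Fin.natAdd n i)) := by
              intro z; funext i
              apply Function.update_of_ne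
              simp only [ne_eq, Fin.ext_iff, Fin.val_natAdd, Fin.val_castAdd]; omega
            simp only [h1, h2, f.map_update_smul, smul_mul_assoc]
          · have h1 : ∀ z, (fun i : Fin m => Function.update a (Fin.natAdd n j) z (Fin.natAdd n i)) =
                Function.update (fun i : Fin m => a (Fin.natAdd n i)) j z := by
              intro z; funext i; simp [Function.update_apply]
            have h2 : ∀ z, (fun i : Fin n => Function.update a (Fin.natAdd n j) z (Fin.castAdd m i)) =
                (fun i : Fin n => a (Fin.castAdd m i)) := by
              intro z; funext i
              apply Function.update_of_ne
              simp only [ne_eq, Fin.ext_iff, Fin.val_natAdd, Fin.val_castAdd]; omega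
            simp only [h1, h2, g.map_update_smul, mul_smul_comm] })
    (by intro f f' g; ext a; simp [add_mul])
    (by intro c f g; ext a; simp)
    (by intro f g g'; ext a; simp [mul_add])
    (by intro c f g; ext a; simp)

theorem cup_apply (n m : ℕ) (f : Cochain k A M n) (g : Cochain k A M m) (a : Fin (n + m) → A) :
    cup n m f g a = f (fun i => a (Fin.castAdd m i)) * g (fun i => a (Fin.natAdd n i)) := rfl

end Cochains

/-! ### The group action on cochains, Hochschild cohomology -/

section Action

variable {k A M : Type*} [Field k] [Ring A] [Algebra k A] [Ring M] [Algebra k M]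

section GroupAction

variable {G : Type*} [Group G] [MulSemiringAction G A] [SMulCommClass G k A]
  [MulSemiringAction G M] [SMulCommClass G k M]

/-- The action of `g` on cochains: `(g f)(a₁, …, a_n) = g (f (g⁻¹ a₁, …, g⁻¹ a_n))`. -/
def act (g : G) (n : ℕ) : Cochain k A M n →ₗ[k] Cochain k A M n where
  toFun f := (DistribSMul.toLinearMap k M g).compMultilinearMap
    (f.compLinearMap fun _ => DistribSMul.toLinearMap k A g⁻¹)
  map_add' f f' := by ext a; simp
  map_smul' c f := by ext a; simp

theorem act_apply (g : G) (n : ℕ) (f : Cochain k A M n) (a : Fin n → A) :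
    act g n f a = g • f (fun i => g⁻¹ • a i) := rfl

theorem act_cup (g : G) (n m : ℕ) (f : Cochain k A M n) (f' : Cochain k A M m) :
    act g (n + m) (cup n m f f') = cup n m (act g n f) (act g m f') := by
  ext a
  simp [act_apply, cup_apply, smul_mul']

variable (k A M G) in
/-- `C^n(A, M)^G`. -/
def invCochain (n : ℕ) : Submodule k (Cochain k A M n) where
  carrier := {f | ∀ g : G, act g n f = f}
  add_mem' hf hf' g := by rw [map_add, hf g, hf' g]
  zero_mem' g := map_zero _
  smul_mem' c f hf g := by rw [map_smul, hf g]

theorem cup_mem_invCochain {n m : ℕ} {f : Cochain k A M n} {g : Cochain k A M m}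
    (hf : f ∈ invCochain k A M G n) (hg : g ∈ invCochain k A M G m) :
    cup n m f g ∈ invCochain k A M G (n + m) := fun α => by
  rw [act_cup, hf α, hg α]

end GroupAction

variable [Module A M] [Module Aᵐᵒᵖ M] [IsScalarTower k A M] [IsScalarTower k Aᵐᵒᵖ M]

variable (k A M) in
/-- The cocycles `Ker δ^n`. -/
def cocycles (n : ℕ) : Submodule k (Cochain k A M n) := LinearMap.ker (d n)

/-- For a graded subspace `S` of `C(A, M)`: the space `δ^{n-1}(S^{n-1})`, which is `0` for `n = 0`. -/
def boundaries (S : ∀ n, Submodule k (Cochain k A M n)) : ∀ n, Submodule k (Cochain k A M n)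
  | 0 => ⊥
  | n + 1 => (S n).map (d n)

theorem mem_boundaries_of_cast {S : ∀ n, Submodule k (Cochain k A M n)} {j N : ℕ} (h : j + 1 = N)
    {t : Cochain k A M j} (ht : t ∈ S j) {f : Cochain k A M N}
    (hf : ∀ a : Fin N → A, f a = d j t (fun i => a (Fin.cast h i))) : f ∈ boundaries S N := by
  subst h
  exact ⟨t, ht, by ext a; exact (hf a).symm⟩

variable (k A M) in
/-- The Hochschild cohomology `HH^n(A, M) = Ker δ^n / Im δ^{n-1}`. -/
abbrev HH (n : ℕ) : Type _ :=
  Subquot (cocycles k A M n) (boundaries (fun _ => ⊤) n)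

variable (k A M) in
/-- `HH^n(A, M)^{G↑}`, the `n`-th cohomology of the subcomplex `C(A, M)^G`. -/
abbrev HHup (G : Type*) [Group G] [MulSemiringAction G A] [SMulCommClass G k A]
    [MulSemiringAction G M] [SMulCommClass G k M] (n : ℕ) : Type _ :=
  Subquot (cocycles k A M n ⊓ invCochain k A M G n) (boundaries (invCochain k A M G) n)

theorem d_cup_apply
    (h₁ : ∀ (a : A) (x y : M), (a • x) * y = a • (x * y))
    (h₂ : ∀ (a : A) (x y : M), x * (op a • y) = op a • (x * y))
    (h₃ : ∀ (a : A) (x y : M), (op a • x) * y = x * (a • y))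
    {n m : ℕ} (f : Cochain k A M n) (g : Cochain k A M m) (a : Fin (n + m + 1) → A) :
    d (n + m) (cup n m f g) a =
      d n f (fun i => a ⟨i, by omega⟩) * g (fun i => a ⟨n + 1 + i, by omega⟩) +
      ((-1 : k) ^ n) • (f (fun i => a ⟨i, by omega⟩) * d m g (fun i => a ⟨n + i, by omega⟩)) := by
  have e₁ : ∀ i : Fin n,
      cup n m f g (Fin.contractNth (Fin.castAdd m i).castSucc (· * ·) a) =
      f (Fin.contractNth i.castSucc (· * ·) (fun i : Fin (n + 1) => a ⟨i, by omega⟩)) *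
        g (fun i => a ⟨n + 1 + i, by omega⟩) := by
    intro i
    rw [cup_apply]
    congr 2
    · funext j
      simp only [Fin.contractNth, Fin.val_castSucc, Fin.val_castAdd, Fin.val_natAdd]
      rw [if_neg (by omega), if_neg (by omega)]
      congr 1
      ext
      simp only [Fin.val_succ, Fin.val_natAdd]
      omega
  have e₂ : ∀ i : Fin m,
      cup n m f g (Fin.contractNth (Fin.natAdd n i).castSucc (· * ·) a) =
      f (fun i => a ⟨i, by omega⟩) *
        g (Fin.contractNth i.castSucc (· * ·) (fun i : Fin (m + 1) => a ⟨n + i, by omega⟩)) := by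
    intro i
    rw [cup_apply]
    congr 2
    · funext j
      simp only [Fin.contractNth, Fin.val_castSucc, Fin.val_castAdd, Fin.val_natAdd]
      rw [if_pos (by omega)]
      rfl
    · funext j
      simp only [Fin.contractNth, Fin.val_castSucc, Fin.val_natAdd, Nat.add_lt_add_iff_left,
        Nat.add_left_cancel_iff]
      rfl
  rw [d_apply, d_apply, d_apply, Fin.sum_univ_add]
  simp only [e₁, e₂, Fin.val_castAdd, Fin.val_natAdd, cup_apply]
  have e₃ : (fun i : Fin m => a (Fin.natAdd n i).succ) =
      (fun i : Fin m => a ⟨n + 1 + i, by omega⟩) := by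
    funext i
    congr 1
    ext
    simp only [Fin.val_succ, Fin.val_natAdd]
    omega
  have e₄ : (fun i : Fin m => a ⟨n + (i.succ : Fin (m + 1)), by omega⟩) =
      (fun i : Fin m => a ⟨n + 1 + i, by omega⟩) := by
    funext i
    congr 1
    ext
    simp only [Fin.val_succ]
    omega
  rw [e₃, e₄]
  set F₀ := f (fun i : Fin n => a (Fin.castAdd m i).succ)
  set F₁ := f (fun i : Fin n => a ⟨i, by omega⟩)
  set G₀ := g (fun i : Fin m => a ⟨n + 1 + i, by omega⟩)
  set G₁ := g (fun i : Fin m => a ⟨n + i, by omega⟩)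
  have e₅ : f (fun i : Fin n => a (Fin.castAdd m i).castSucc) = F₁ := rfl
  have e₆ : g (fun i : Fin m => a (Fin.natAdd n i).castSucc) = G₁ := rfl
  have e₇ : f (fun i : Fin n => a ⟨(i.succ : Fin (n + 1)), by omega⟩) = F₀ := rfl
  have e₈ : f (fun i : Fin n => a ⟨(i.castSucc : Fin (n + 1)), by omega⟩) = F₁ := rfl
  have e₉ : g (fun i : Fin m => a ⟨n + (i.castSucc : Fin (m + 1)), by omega⟩) = G₁ := rfl
  rw [e₅, e₆, e₇, e₈, e₉]
  have e₁₀ : a ⟨n + ((0 : Fin (m + 1)) : ℕ), by omega⟩ =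
      a ⟨((Fin.last n : Fin (n + 1)) : ℕ), by simp⟩ := rfl
  have e₁₁ : a ⟨n + ((Fin.last m : Fin (m + 1)) : ℕ), by simp⟩ = a (Fin.last (n + m)) := rfl
  have e₁₂ : a ⟨((0 : Fin (n + 1)) : ℕ), by simp⟩ = a 0 := rfl
  rw [e₁₀, e₁₁, e₁₂]
  simp only [add_mul, mul_add, h₁, h₂, h₃, smul_mul_assoc, mul_smul_comm, Finset.sum_mul,
    Finset.mul_sum, smul_add, Finset.smul_sum, smul_smul]
  have e₁₃ : ∀ i : Fin m, (-1 : k) ^ n * (-1) ^ (i.val + 1) = (-1) ^ (n + i.val + 1) := by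
    intro i; ring
  have e₁₄ : (-1 : k) ^ n * (-1) ^ (m + 1) = (-1) ^ (n + m + 1) := by ring
  have e₁₅ : (-1 : k) ^ (n + 1) = - (-1) ^ n := by ring
  simp only [e₁₃, e₁₄, e₁₅, neg_smul]
  abel

theorem cup_mem_cocycles
    (h₁ : ∀ (a : A) (x y : M), (a • x) * y = a • (x * y))
    (h₂ : ∀ (a : A) (x y : M), x * (op a • y) = op a • (x * y))
    (h₃ : ∀ (a : A) (x y : M), (op a • x) * y = x * (a • y))
    {n m : ℕ} {f : Cochain k A M n} {g : Cochain k A M m}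
    (hf : f ∈ cocycles k A M n) (hg : g ∈ cocycles k A M m) :
    cup n m f g ∈ cocycles k A M (n + m) := by
  rw [cocycles, LinearMap.mem_ker] at *
  ext a
  rw [d_cup_apply h₁ h₂ h₃, hf, hg]
  simp

/-- The product of a coboundary with a cocycle is a coboundary. -/
theorem cup_mem_boundaries_left
    (h₁ : ∀ (a : A) (x y : M), (a • x) * y = a • (x * y))
    (h₂ : ∀ (a : A) (x y : M), x * (op a • y) = op a • (x * y))
    (h₃ : ∀ (a : A) (x y : M), (op a • x) * y = x * (a • y))
    {S : ∀ n, Submodule k (Cochain k A M n)}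
    {n m : ℕ} {f : Cochain k A M n} {g : Cochain k A M m}
    (hS : ∀ j, ∀ t ∈ S j, cup j m t g ∈ S (j + m))
    (hf : f ∈ boundaries S n) (hg : g ∈ cocycles k A M m) :
    cup n m f g ∈ boundaries S (n + m) := by
  rw [cocycles, LinearMap.mem_ker] at hg
  cases n with
  | zero =>
    obtain rfl : f = 0 := hf
    simp
  | succ j =>
    obtain ⟨t, ht, rfl⟩ := hf
    refine mem_boundaries_of_cast (j := j + m) (by omega) (hS j t ht) fun a => ?_
    rw [d_cup_apply h₁ h₂ h₃, hg, cup_apply]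
    simp only [zero_apply, mul_zero, smul_zero, add_zero]
    rfl

/-- The product of a cocycle with a coboundary is a coboundary. -/
theorem cup_mem_boundaries_right
    (h₁ : ∀ (a : A) (x y : M), (a • x) * y = a • (x * y))
    (h₂ : ∀ (a : A) (x y : M), x * (op a • y) = op a • (x * y))
    (h₃ : ∀ (a : A) (x y : M), (op a • x) * y = x * (a • y))
    {S : ∀ n, Submodule k (Cochain k A M n)}
    {n m : ℕ} {f : Cochain k A M n} {g : Cochain k A M m}
    (hS : ∀ j, ∀ t ∈ S j, cup n j f t ∈ S (n + j))
    (hf : f ∈ cocycles k A M n) (hg : g ∈ boundaries S m) :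
    cup n m f g ∈ boundaries S (n + m) := by
  rw [cocycles, LinearMap.mem_ker] at hf
  cases m with
  | zero =>
    obtain rfl : g = 0 := hg
    simp
  | succ j =>
    obtain ⟨t, ht, rfl⟩ := hg
    refine mem_boundaries_of_cast (j := n + j) (t := ((-1 : k) ^ n) • cup n j f t) (by omega)
      ((S (n + j)).smul_mem _ (hS j t ht)) fun a => ?_
    rw [map_smul, smul_apply, d_cup_apply h₁ h₂ h₃, hf, cup_apply, smul_add,
      smul_smul, ← mul_pow]
    simp only [zero_apply, zero_mul, smul_zero, zero_add, mul_neg, mul_one, neg_neg,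
      one_pow, one_smul]
    rfl

end Action

/-! ### Hochschild cohomology as a graded algebra with a `G`-action -/

section Cohomology

variable (k A M G : Type*) [Field k] [Ring A] [Algebra k A] [Ring M] [Algebra k M]
  [Module A M] [Module Aᵐᵒᵖ M] [SMulCommClass A Aᵐᵒᵖ M]
  [IsScalarTower k A M] [IsScalarTower k Aᵐᵒᵖ M]
  [Group G] [MulSemiringAction G A] [SMulCommClass G k A]
  [MulSemiringAction G M] [SMulCommClass G k M] [hM : IsAeGModuleAlgebra k A M G]

variable {k A M G} in
theorem d_act (g : G) (n : ℕ) (f : Cochain k A M n) : d n (act g n f) = act g (n + 1) (d n f) := by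
  ext a
  have h : ∀ i : Fin n, (fun j => g⁻¹ • Fin.contractNth i.castSucc (· * ·) a j) =
      Fin.contractNth i.castSucc (· * ·) (fun j => g⁻¹ • a j) := by
    intro i
    exact Fin.comp_contractNth (f := fun x : A => g⁻¹ • x) _ _ (fun x y => smul_mul' _ _ _) _ _
  simp only [act_apply, d_apply, smul_add, Finset.smul_sum, hM.group_smul, hM.group_op_smul, h,
    smul_inv_smul, smul_comm g]

/-- The cup product `HH^n(A, M) × HH^m(A, M) → HH^{n+m}(A, M)`. -/
def cupHH (n m : ℕ) : HH k A M n →ₗ[k] HH k A M m →ₗ[k] HH k A M (n + m) :=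
  Subquot.map₂ (cup n m)
    (cocycles k A M n) (boundaries (fun _ => ⊤) n)
    (cocycles k A M m) (boundaries (fun _ => ⊤) m)
    (cocycles k A M (n + m)) (boundaries (fun _ => ⊤) (n + m))
    (fun _ hf _ hg => cup_mem_cocycles hM.smul_mul hM.mul_op_smul hM.op_smul_mul hf hg)
    (fun _ _ hf _ hg => cup_mem_boundaries_left hM.smul_mul hM.mul_op_smul hM.op_smul_mul
      (fun _ _ _ => Submodule.mem_top) hf hg)
    (fun _ hf _ _ hg => cup_mem_boundaries_right hM.smul_mul hM.mul_op_smul hM.op_smul_mul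
      (fun _ _ _ => Submodule.mem_top) hf hg)

/-- The cup product `HH^n(A, M)^{G↑} × HH^m(A, M)^{G↑} → HH^{n+m}(A, M)^{G↑}`. -/
def cupUp (n m : ℕ) : HHup k A M G n →ₗ[k] HHup k A M G m →ₗ[k] HHup k A M G (n + m) :=
  Subquot.map₂ (cup n m)
    (cocycles k A M n ⊓ invCochain k A M G n) (boundaries (invCochain k A M G) n)
    (cocycles k A M m ⊓ invCochain k A M G m) (boundaries (invCochain k A M G) m)
    (cocycles k A M (n + m) ⊓ invCochain k A M G (n + m)) (boundaries (invCochain k A M G) (n + m))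
    (fun _ hf _ hg => ⟨cup_mem_cocycles hM.smul_mul hM.mul_op_smul hM.op_smul_mul hf.1 hg.1,
      cup_mem_invCochain hf.2 hg.2⟩)
    (fun _ _ hf _ hg => cup_mem_boundaries_left hM.smul_mul hM.mul_op_smul hM.op_smul_mul
      (fun _ _ ht => cup_mem_invCochain ht hg.2) hf hg.1)
    (fun _ hf _ _ hg => cup_mem_boundaries_right hM.smul_mul hM.mul_op_smul hM.op_smul_mul
      (fun _ _ ht => cup_mem_invCochain hf.2 ht) hf.1 hg)

/-- The homomorphism `Θ : HH^n(A, M)^{G↑} → HH^n(A, M)` induced by `C(A, M)^G ⊂ C(A, M)`; its image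
lies in `HH^n(A, M)^G`. -/
def Theta (n : ℕ) : HHup k A M G n →ₗ[k] HH k A M n :=
  Subquot.map LinearMap.id _ _ _ _ (fun _ hf => hf.1) (fun f _ hf => by
    cases n with
    | zero => exact hf
    | succ n =>
      obtain ⟨t, _, rfl⟩ := hf
      exact ⟨t, trivial, rfl⟩)

/-- The action of `g ∈ G` on `HH^n(A, M)`. -/
def actHH (g : G) (n : ℕ) : HH k A M n →ₗ[k] HH k A M n :=
  Subquot.map (act g n) _ _ _ _
    (fun f hf => by
      rw [cocycles, LinearMap.mem_ker] at *
      rw [d_act, hf, map_zero])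
    (fun f _ hf => by
      cases n with
      | zero =>
        obtain rfl : f = 0 := hf
        simp
      | succ n =>
        obtain ⟨t, _, rfl⟩ := hf
        exact ⟨act g n t, trivial, d_act g n t⟩)

/-- `HH^n(A, M)^K`, the elements of `HH^n(A, M)` fixed by the subgroup `K` of `G`. -/
def invHH (K : Subgroup G) (n : ℕ) : Submodule k (HH k A M n) where
  carrier := {x | ∀ g ∈ K, actHH k A M G g n x = x}
  add_mem' hx hy g hg := by rw [map_add, hx g hg, hy g hg]
  zero_mem' g _ := map_zero _
  smul_mem' c x hx g hg := by rw [map_smul, hx g hg]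

/-- The operator `Δ_ρ = 1 - ρ` on `HH^n(A, M)`. -/
def DeltaHH (ρ : G) (n : ℕ) : Module.End k (HH k A M n) := 1 - actHH k A M G ρ n

/-- The operator `Δ_ρ = 1 - ρ` on `M`. -/
def DeltaM (ρ : G) : Module.End k M := 1 - DistribSMul.toLinearMap k M ρ

theorem actHH_cupHH (g : G) (n m : ℕ) (x : HH k A M n) (y : HH k A M m) :
    actHH k A M G g (n + m) (cupHH k A M G n m x y) =
      cupHH k A M G n m (actHH k A M G g n x) (actHH k A M G g m y) := by
  obtain ⟨f, rfl⟩ := Subquot.mk_surjective _ _ x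
  obtain ⟨f', rfl⟩ := Subquot.mk_surjective _ _ y
  simp only [actHH, cupHH, Subquot.map_mk, Subquot.map₂_mk, act_cup]

theorem Theta_cupUp (n m : ℕ) (x : HHup k A M G n) (y : HHup k A M G m) :
    Theta k A M G (n + m) (cupUp k A M G n m x y) =
      cupHH k A M G n m (Theta k A M G n x) (Theta k A M G m y) := by
  obtain ⟨f, rfl⟩ := Subquot.mk_surjective _ _ x
  obtain ⟨f', rfl⟩ := Subquot.mk_surjective _ _ y
  rfl

theorem Theta_mem_invHH (n : ℕ) (x : HHup k A M G n) : Theta k A M G n x ∈ invHH k A M G ⊤ n := by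
  obtain ⟨f, rfl⟩ := Subquot.mk_surjective _ _ x
  intro g _
  simp only [Theta, actHH, Subquot.map_mk, LinearMap.id_apply, f.2.2 g]

theorem cupHH_mem_invHH {n m : ℕ} {x : HH k A M n} {y : HH k A M m}
    (hx : x ∈ invHH k A M G ⊤ n) (hy : y ∈ invHH k A M G ⊤ m) :
    cupHH k A M G n m x y ∈ invHH k A M G ⊤ (n + m) := fun g hg => by
  rw [actHH_cupHH, hx g hg, hy g hg]

end Cohomology

/-! ### Graded bimodules, their graded subbimodules, quotients and isomorphisms -/

section GradedAction

/-- The left and right multiplications of a graded bimodule `V = ⊕ V_n` over a graded algebra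
`R = ⊕ R_n`: `left m n b x = b x` and `right m n b x = x b` for `b ∈ R_m`, `x ∈ V_n`. -/
structure GradedAction (k : Type*) [Field k] (R V : ℕ → Type*)
    [∀ n, AddCommGroup (R n)] [∀ n, Module k (R n)]
    [∀ n, AddCommGroup (V n)] [∀ n, Module k (V n)] where
  left : ∀ m n, R m →ₗ[k] V n →ₗ[k] V (m + n)
  right : ∀ m n, R m →ₗ[k] V n →ₗ[k] V (n + m)

variable {k : Type*} [Field k] {R V W : ℕ → Type*}
  [∀ n, AddCommGroup (R n)] [∀ n, Module k (R n)]
  [∀ n, AddCommGroup (V n)] [∀ n, Module k (V n)]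
  [∀ n, AddCommGroup (W n)] [∀ n, Module k (W n)]

/-- `S = ⊕ S_n` is a graded subbimodule of `V`. -/
def GradedAction.IsSubbimodule (P : GradedAction k R V) (S : ∀ n, Submodule k (V n)) : Prop :=
  ∀ (m n : ℕ) (b : R m), ∀ x ∈ S n, P.left m n b x ∈ S (m + n) ∧ P.right m n b x ∈ S (n + m)

/-- The graded bimodule `S / S'`, for graded subbimodules `S' ⊂ S` of `V`. -/
def GradedAction.quotient (P : GradedAction k R V) {S S' : ∀ n, Submodule k (V n)}
    (hS : P.IsSubbimodule S) (hS' : P.IsSubbimodule S') :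
    GradedAction k R (fun n => Subquot (S n) (S' n)) where
  left m n := Subquot.mapRight (P.left m n) (S n) (S' n) (S (m + n)) (S' (m + n))
    (fun b x hx => (hS m n b x hx).1) (fun b x _ hx => (hS' m n b x hx).1)
  right m n := Subquot.mapRight (P.right m n) (S n) (S' n) (S (n + m)) (S' (n + m))
    (fun b x hx => (hS m n b x hx).2) (fun b x _ hx => (hS' m n b x hx).2)

/-- An isomorphism of graded bimodules (it preserves degrees). -/
structure GradedAction.Iso (P : GradedAction k R V) (Q : GradedAction k R W) where
  equiv : ∀ n, V n ≃ₗ[k] W n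
  map_left : ∀ (m n : ℕ) (b : R m) (x : V n),
    equiv (m + n) (P.left m n b x) = Q.left m n b (equiv n x)
  map_right : ∀ (m n : ℕ) (b : R m) (x : V n),
    equiv (n + m) (P.right m n b x) = Q.right m n b (equiv n x)

end GradedAction

/-! ### The algebra `𝒜`, the bimodules `X` and `Y`, degenerated algebras -/

section Main

variable (k A M G : Type*) [Field k] [Ring A] [Algebra k A] [Ring M] [Algebra k M]
  [Module A M] [Module Aᵐᵒᵖ M] [SMulCommClass A Aᵐᵒᵖ M]
  [IsScalarTower k A M] [IsScalarTower k Aᵐᵒᵖ M]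
  [Group G] [MulSemiringAction G A] [SMulCommClass G k A]
  [MulSemiringAction G M] [SMulCommClass G k M] [hM : IsAeGModuleAlgebra k A M G]

/-- The degree `n` part of the graded algebra `𝒜 = Im Θ ⊂ HH^*(A, M)^G`. -/
def imTheta (n : ℕ) : Submodule k (HH k A M n) := LinearMap.range (Theta k A M G n)

/-- The degree `n` part of `X = Ker Θ ⊂ HH^*(A, M)^{G↑}`. -/
def kerTheta (n : ℕ) : Submodule k (HHup k A M G n) := LinearMap.ker (Theta k A M G n)

/-- The degree `n` part of `Y = HH^*(A, M)^G / Im Θ`. -/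
abbrev cokerTheta (n : ℕ) : Type _ := Subquot (invHH k A M G ⊤ n) (imTheta k A M G n)

/-- `Θ` as a map onto `𝒜`. -/
def toImTheta (n : ℕ) : HHup k A M G n →ₗ[k] imTheta k A M G n := (Theta k A M G n).rangeRestrict

theorem imTheta_le_invHH (n : ℕ) : imTheta k A M G n ≤ invHH k A M G ⊤ n := by
  rintro _ ⟨x, rfl⟩
  exact Theta_mem_invHH k A M G n x

variable {k A M G} in
theorem cupHH_mem_imTheta {n m : ℕ} {x : HH k A M n} {y : HH k A M m}
    (hx : x ∈ imTheta k A M G n) (hy : y ∈ imTheta k A M G m) :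
    cupHH k A M G n m x y ∈ imTheta k A M G (n + m) := by
  obtain ⟨x, rfl⟩ := hx
  obtain ⟨y, rfl⟩ := hy
  exact ⟨cupUp k A M G n m x y, Theta_cupUp k A M G n m x y⟩

/-- The `𝒜`-bimodule structure of `Y`, given by the cup product of `HH^*(A, M)^G`. -/
def cokerAction : GradedAction k (fun n => imTheta k A M G n) (fun n => cokerTheta k A M G n) where
  left m n := Subquot.mapRight ((cupHH k A M G m n).comp (imTheta k A M G m).subtype)
    (invHH k A M G ⊤ n) (imTheta k A M G n) (invHH k A M G ⊤ (m + n)) (imTheta k A M G (m + n))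
    (fun b _ hx => cupHH_mem_invHH k A M G (imTheta_le_invHH k A M G m b.2) hx)
    (fun b _ _ hx => cupHH_mem_imTheta b.2 hx)
  right m n := Subquot.mapRight ((cupHH k A M G n m).flip.comp (imTheta k A M G m).subtype)
    (invHH k A M G ⊤ n) (imTheta k A M G n) (invHH k A M G ⊤ (n + m)) (imTheta k A M G (n + m))
    (fun b _ hx => cupHH_mem_invHH k A M G hx (imTheta_le_invHH k A M G m b.2))
    (fun b _ _ hx => cupHH_mem_imTheta hx b.2)

/-- `P` is the `𝒜`-bimodule structure of `X` induced by the cup product of `HH^*(A, M)^{G↑}`: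
`Θ(b) x = b ⌣ x` and `x Θ(b) = x ⌣ b`.  There is at most one such `P`, and there is one if and only
if the ideal `X` has square zero. -/
def IsKerAction (P : GradedAction k (fun n => imTheta k A M G n) (fun n => kerTheta k A M G n)) :
    Prop :=
  ∀ (m n : ℕ) (b : HHup k A M G m) (x : kerTheta k A M G n),
    (P.left m n (toImTheta k A M G m b) x : HHup k A M G (m + n)) = cupUp k A M G m n b x ∧
    (P.right m n (toImTheta k A M G m b) x : HHup k A M G (n + m)) = cupUp k A M G n m x b

variable {k A M G}

/-- `M` is an `(𝐦, 𝐡)`-degenerated algebra: `𝐦 ∈ M^H` and `𝐡 ∈ Der(A, M)^H` satisfy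
`Δ_ρ^{q-1} 𝐦 = 1` and `Δ_ρ 𝐡 + φ_𝐦 = 0`, where `φ_𝐦(a) = a 𝐦 - 𝐦 a`.  Here `H` is a normal subgroup
of `G`, `ρ ∈ G` represents a generator of the cyclic group `G / H`, `q` is the order of `G / H`. -/
structure IsDegenerated (H : Subgroup G) (ρ : G) (q : ℕ) (m : M) (h : A →ₗ[k] M) : Prop where
  m_inv : ∀ g ∈ H, g • m = m
  h_inv : ∀ g ∈ H, ∀ a, g • h (g⁻¹ • a) = h a
  h_der : ∀ a b, h (a * b) = a • h b + op b • h a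
  norm_m : (DeltaM k M G ρ ^ (q - 1)) m = 1
  delta_h : ∀ a, (h a - ρ • h (ρ⁻¹ • a)) + (a • m - op a • m) = 0

end Main

end HochG

/-!
Write `Δ = 1 - ρ`. On the `H`-invariant cochains `Δ ^ q = 1 - ρ ^ q = 0`, and multiplication by an
element `m` with `Δ ^ (q - 1) m = 1` forces `ker Δ ^ a = im Δ ^ (q - a)` for `a ≤ q`. Twisting the
action of `ρ` and the differential on pairs of cochains by `m` and `h` turns `Δ ^ q` into
`(u, v) ↦ (-v, 0)`, and this shows that a coboundary of the form `Δ ^ j w` is `Δ ^ j` of a cocycle.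
Consequently, for a cocycle `w` whose class is killed by `Δ ^ (i + 1)`, the assignments sending `w`
to the class of `Δ ^ i w` in the cokernel of `Θ` and to the class of `Δ ^ (q - 1) w` in the kernel
of `Θ` induce the isomorphisms between the graded pieces of the two filtrations.
-/

namespace HochG

open MulOpposite

section LinearAlgebra

variable {k V W : Type*} [Field k] [AddCommGroup V] [Module k V] [AddCommGroup W] [Module k W]

theorem one_sub_pow_char_pow {R : Type*} [Ring R] (k : Type*) [Field k] [Algebra k R]
    (p : ℕ) [Fact p.Prime] [CharP k p] (e : ℕ) (r : R) :
    (1 - r) ^ p ^ e = 1 - r ^ p ^ e := by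
  have h : (1 - Polynomial.X : Polynomial k) ^ p ^ e = 1 - Polynomial.X ^ p ^ e := by
    rw [sub_pow_char_pow, one_pow]
  simpa using congrArg (Polynomial.aeval r) h

theorem one_sub_pow_char_pow_sub_one {R : Type*} [Ring R] (k : Type*) [Field k] [Algebra k R]
    (p : ℕ) [Fact p.Prime] [CharP k p] (e : ℕ) (r : R) :
    (1 - r) ^ (p ^ e - 1) = ∑ a ∈ Finset.range (p ^ e), r ^ a := by
  have h : (1 - Polynomial.X : Polynomial k) ^ (p ^ e - 1) =
      ∑ a ∈ Finset.range (p ^ e), Polynomial.X ^ a := by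
    have h0 : (1 - Polynomial.X : Polynomial k) ≠ 0 := fun h => by
      simpa using congrArg (Polynomial.eval 0) h
    apply mul_left_cancel₀ h0
    rw [← pow_succ', Nat.sub_add_cancel (pow_pos (Fact.out : p.Prime).pos e), mul_neg_geom_sum,
      sub_pow_char_pow, one_pow]
  simpa using congrArg (Polynomial.aeval r) h

theorem pow_apply_pow_apply {T : Module.End k V} {a b c : ℕ} (h : a + b = c) (v : V) :
    (T ^ a) ((T ^ b) v) = (T ^ c) v := by
  rw [← h, pow_add, Module.End.mul_apply]

theorem map_pow_apply {φ : V →ₗ[k] W} {S : Module.End k V} {T : Module.End k W}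
    (h : ∀ v, φ (S v) = T (φ v)) (j : ℕ) (v : V) : φ ((S ^ j) v) = (T ^ j) (φ v) := by
  simpa only [Module.End.pow_apply] using Function.Semiconj.iterate_right h j v

theorem exists_pow_apply_eq_of_pow_apply_eq_zero {T : Module.End k V} {U : Submodule k V}
    (hU : ∀ v ∈ U, T v ∈ U) {q : ℕ} (hT : ∀ v ∈ U, T v = 0 → ∃ w ∈ U, (T ^ (q - 1)) w = v)
    {a : ℕ} (ha : a ≤ q) {v : V} (hv : v ∈ U) (hav : (T ^ a) v = 0) :
    ∃ w ∈ U, (T ^ (q - a)) w = v := by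
  induction a generalizing v with
  | zero => exact ⟨0, U.zero_mem, by simpa using hav.symm⟩
  | succ a ih =>
    have hTa : T ((T ^ a) v) = 0 := by rwa [← Module.End.mul_apply, ← pow_succ']
    obtain ⟨w, hw, hwv⟩ := hT _ (Module.End.pow_apply_mem_of_forall_mem a hU v hv) hTa
    have hcorr : (T ^ a) (v - (T ^ (q - (a + 1))) w) = 0 := by
      rw [map_sub, ← Module.End.mul_apply, ← pow_add,
        show a + (q - (a + 1)) = q - 1 by omega, hwv, sub_self]
    obtain ⟨u, hu, huv⟩ := ih (by omega)
      (U.sub_mem hv (Module.End.pow_apply_mem_of_forall_mem _ hU w hw)) hcorr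
    refine ⟨w + T u, U.add_mem hw (hU u hu), ?_⟩
    rw [map_add, ← Module.End.mul_apply _ T, ← pow_succ, show q - (a + 1) + 1 = q - a by omega,
      huv, add_sub_cancel]

namespace Subquot

variable {P P' : Submodule k V}

theorem mk_eq_mk {v w : P} : mk P P' v = mk P P' w ↔ (v - w : V) ∈ P' := by
  rw [← sub_eq_zero, ← map_sub, mk_eq_zero, Submodule.coe_sub]

theorem subsingleton_iff : Subsingleton (Subquot P P') ↔ P ≤ P' := by
  refine ⟨fun _ v hv => (mk_eq_zero ⟨v, hv⟩).1 (Subsingleton.elim _ _), fun h => ⟨fun x y => ?_⟩⟩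
  obtain ⟨v, rfl⟩ := mk_surjective P P' x
  obtain ⟨w, rfl⟩ := mk_surjective P P' y
  exact mk_eq_mk.2 (P'.sub_mem (h v.2) (h w.2))

end Subquot

end LinearAlgebra

section Representation

variable {k G V W : Type*} [Field k] [Group G] [AddCommGroup V] [Module k V]
  [AddCommGroup W] [Module k W]

/-- The subspace `V^H` of the vectors fixed by a subgroup `H`. -/
noncomputable def fixed (τ : Representation k G V) (H : Subgroup G) : Submodule k V :=
  Representation.invariants (τ.comp H.subtype)

/-- The operator `Δ_ρ = 1 - ρ` of a representation. -/
def delta (τ : Representation k G V) (ρ : G) : Module.End k V := 1 - τ ρ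

variable {τ : Representation k G V} {σ : Representation k G W} {H : Subgroup G} {ρ : G} {v : V}

theorem mem_fixed_iff : v ∈ fixed τ H ↔ ∀ g ∈ H, τ g v = v := Subtype.forall

theorem delta_apply : delta τ ρ v = v - τ ρ v := rfl

theorem delta_mem_fixed [H.Normal] (hv : v ∈ fixed τ H) : delta τ ρ v ∈ fixed τ H :=
  Submodule.sub_mem _ hv (Representation.le_comap_invariants τ H ρ hv)

theorem delta_pow_mem_fixed [H.Normal] (j : ℕ) (hv : v ∈ fixed τ H) :
    (delta τ ρ ^ j) v ∈ fixed τ H :=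
  Module.End.pow_apply_mem_of_forall_mem j (fun _ => delta_mem_fixed) v hv

theorem map_delta_pow {φ : V →ₗ[k] W} (hφ : ∀ v, φ (τ ρ v) = σ ρ (φ v)) (j : ℕ) (v : V) :
    φ ((delta τ ρ ^ j) v) = (delta σ ρ ^ j) (φ v) :=
  map_pow_apply (fun v => by rw [delta_apply, map_sub, hφ, delta_apply]) j v

theorem delta_pow_char_pow_eq_zero (p : ℕ) [Fact p.Prime] [CharP k p] {e : ℕ}
    (hρ : ρ ^ p ^ e ∈ H) (hv : v ∈ fixed τ H) : (delta τ ρ ^ p ^ e) v = 0 := by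
  rw [delta, one_sub_pow_char_pow k, ← map_pow, LinearMap.sub_apply, mem_fixed_iff.1 hv _ hρ,
    Module.End.one_apply, sub_self]

theorem delta_pow_char_pow_sub_one_apply (p : ℕ) [Fact p.Prime] [CharP k p] (e : ℕ) (v : V) :
    (delta τ ρ ^ (p ^ e - 1)) v = ∑ a ∈ Finset.range (p ^ e), τ (ρ ^ a) v := by
  simp only [delta, one_sub_pow_char_pow_sub_one k, LinearMap.sum_apply, map_pow]

theorem mem_fixed_top_iff (hρ : H ⊔ Subgroup.zpowers ρ = ⊤) :
    v ∈ fixed τ ⊤ ↔ v ∈ fixed τ H ∧ delta τ ρ v = 0 := by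
  simp only [mem_fixed_iff, delta_apply, sub_eq_zero, eq_comm (a := v) (b := τ ρ v)]
  refine ⟨fun h => ⟨fun g _ => h g trivial, h ρ trivial⟩, fun ⟨hvH, hvρ⟩ => ?_⟩
  let _ : MulAction G V := MulAction.compHom V τ
  have h : H ⊔ Subgroup.zpowers ρ ≤ MulAction.stabilizer G v :=
    sup_le hvH (Subgroup.zpowers_le.2 hvρ)
  exact fun g _ => h (hρ ▸ Subgroup.mem_top g)

theorem exists_mem_fixed_sub_mem (hH : (Nat.card H : k) ≠ 0) {S : Submodule k V}
    (hv : ∀ g ∈ H, τ g v - v ∈ S) : ∃ w ∈ fixed τ H, w - v ∈ S := by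
  have : Finite H := Nat.finite_of_card_ne_zero fun h => hH (by rw [h, Nat.cast_zero])
  have := Fintype.ofFinite H
  have hcard : (Fintype.card H : k) ≠ 0 := by rwa [← Nat.card_eq_fintype_card]
  let _ := invertibleOfNonzero hcard
  refine ⟨_, Representation.averageMap_invariant (τ.comp H.subtype) v, ?_⟩
  have havg : Representation.averageMap (τ.comp H.subtype) v - v =
      (Fintype.card H : k)⁻¹ • ∑ g : H, (τ g v - v) := by
    rw [Finset.sum_sub_distrib, Finset.sum_const, Finset.card_univ, ← Nat.cast_smul_eq_nsmul k,
      smul_sub, inv_smul_smul₀ hcard, Representation.averageMap]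
    simp [GroupAlgebra.average]
  rw [havg]
  exact S.smul_mem _ (S.sum_mem fun g _ => hv g g.2)

end Representation

section SquareZero

theorem sum_sum_neg_one_pow_eq_zero {R V : Type*} [Ring R] [AddCommGroup V] [Module R V]
    (F : ℕ → ℕ → V) (N : ℕ) (hF : ∀ i j, i ≤ j → j < N → F (j + 1) i = F i j) :
    ∑ j ∈ Finset.range (N + 1), (-1 : R) ^ j • ∑ i ∈ Finset.range N, (-1 : R) ^ i • F j i = 0 := by
  induction N with
  | zero => simp
  | succ N ih =>
    have ih := ih fun i j hij hj => hF i j hij (by omega)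
    simp only [Finset.sum_range_succ _ N] at ih
    have hlast : ∑ i ∈ Finset.range N, (-1 : R) ^ i • F (N + 1) i =
        ∑ i ∈ Finset.range N, (-1 : R) ^ i • F i N :=
      Finset.sum_congr rfl fun i hi => by
        rw [hF i N (Finset.mem_range.1 hi).le N.lt_succ_self]
    rw [Finset.sum_range_succ]
    simp only [Finset.sum_range_succ _ N, smul_add, Finset.sum_add_distrib]
    rw [eq_neg_of_add_eq_zero_left ih, hF N N le_rfl N.lt_succ_self, hlast]
    have hcomm (i : ℕ) : (-1 : R) ^ N * (-1) ^ i = (-1) ^ i * (-1) ^ N :=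
      (Commute.refl _).pow_pow N i
    simp only [pow_succ', one_mul, neg_mul, neg_smul, Finset.smul_sum, smul_smul, hcomm,
      Finset.sum_neg_distrib]
    abel

/-- The sequence `a₀, …, a_i a_{i+1}, a_{i+2}, …`. The faces of the Hochschild differential are
written on sequences `ℕ → A` to have all cochain degrees on the same footing. -/
def contractSeq {A : Type*} [Mul A] (i : ℕ) (a : ℕ → A) (j : ℕ) : A :=
  if j < i then a j else if j = i then a j * a (j + 1) else a (j + 1)

theorem contractSeq_contractSeq {A : Type*} [Semigroup A] {i j : ℕ} (hij : i ≤ j) (a : ℕ → A) :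
    contractSeq i (contractSeq (j + 1) a) = contractSeq j (contractSeq i a) := by
  funext l
  simp only [contractSeq]
  split_ifs <;> first | rfl | omega | rw [mul_assoc]

theorem contractSeq_succ_shift {A : Type*} [Mul A] (i : ℕ) (a : ℕ → A) :
    (fun l => contractSeq (i + 1) a (l + 1)) = contractSeq i fun l => a (l + 1) := by
  funext l
  simp only [contractSeq, add_lt_add_iff_right, add_left_inj]

variable {A M : Type*} [Ring A] [AddCommGroup M] [Module A M] [Module Aᵐᵒᵖ M]

/-- The `i`-th face of the Hochschild differential of an `n`-cochain `φ`, with `φ` regarded as a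
function of sequences that only depends on the terms of index `< n`. -/
def faceSeq (n i : ℕ) (φ : (ℕ → A) → M) (a : ℕ → A) : M :=
  if i = 0 then a 0 • φ (fun j => a (j + 1))
  else if i = n + 1 then op (a n) • φ a
  else φ (contractSeq (i - 1) a)

variable (n : ℕ) (φ : (ℕ → A) → M) (a : ℕ → A)

theorem faceSeq_zero : faceSeq n 0 φ a = a 0 • φ (fun j => a (j + 1)) := rfl

theorem faceSeq_last : faceSeq n (n + 1) φ a = op (a n) • φ a := by
  rw [faceSeq, if_neg n.succ_ne_zero, if_pos rfl]

theorem faceSeq_succ {i : ℕ} (hi : i ≠ n) : faceSeq n (i + 1) φ a = φ (contractSeq i a) := by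
  rw [faceSeq, if_neg i.succ_ne_zero, if_neg (by omega), Nat.add_sub_cancel]

theorem faceSeq_sum_smul {R ι : Type*} [Monoid R] [DistribMulAction R M] [SMulCommClass A R M]
    [SMulCommClass Aᵐᵒᵖ R M] (i : ℕ) (s : Finset ι) (c : ι → R) (ψ : ι → (ℕ → A) → M) :
    faceSeq n i (fun b => ∑ l ∈ s, c l • ψ l b) a = ∑ l ∈ s, c l • faceSeq n i (ψ l) a := by
  simp only [faceSeq]
  split_ifs <;> simp only [Finset.smul_sum, smul_comm (a 0), smul_comm (op (a n))]

variable {n φ}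

theorem faceSeq_faceSeq [SMulCommClass A Aᵐᵒᵖ M] {i j : ℕ} (hij : i ≤ j) (hj : j < n + 2)
    (hφ : ∀ a b : ℕ → A, (∀ l < n, a l = b l) → φ a = φ b) :
    faceSeq (n + 1) (j + 1) (faceSeq n i φ) a = faceSeq (n + 1) i (faceSeq n j φ) a := by
  have := SMulCommClass.symm A Aᵐᵒᵖ M
  obtain rfl | hjn := eq_or_ne j (n + 1)
  · rw [faceSeq_last]
    obtain _ | i := i
    · rw [faceSeq_zero, faceSeq_zero, faceSeq_last, smul_comm]
    · obtain rfl | hi := eq_or_ne i n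
      · have hφa : φ (contractSeq i a) = φ a := hφ _ _ fun l hl => if_pos hl
        rw [faceSeq_last, faceSeq_succ _ _ _ (by omega), faceSeq_last, hφa, contractSeq,
          if_neg (lt_irrefl i), if_pos rfl, op_mul, mul_smul]
      · rw [faceSeq_succ _ _ _ hi, faceSeq_succ _ _ _ (by omega), faceSeq_last, contractSeq,
          if_neg (by omega), if_neg (by omega)]
  · rw [faceSeq_succ _ _ _ hjn]
    obtain _ | i := i
    · rw [faceSeq_zero, faceSeq_zero]
      obtain _ | j := j
      · rw [faceSeq_zero, smul_smul]
        rfl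
      · rw [faceSeq_succ _ _ _ (by omega), contractSeq_succ_shift]
        rfl
    · obtain ⟨j, rfl⟩ := Nat.exists_eq_succ_of_ne_zero (show j ≠ 0 by omega)
      rw [faceSeq_succ _ _ _ (by omega), faceSeq_succ _ _ _ (by omega),
        faceSeq_succ _ _ _ (by omega), contractSeq_contractSeq (by omega)]

end SquareZero

section Cochains

variable {k A M G : Type*} [Field k] [Ring A] [Algebra k A] [Ring M] [Algebra k M]

/-- The product `m f` of an element of `M` and a cochain. -/
def mulCochain (n : ℕ) : M →ₗ[k] Cochain k A M n →ₗ[k] Cochain k A M n :=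
  LinearMap.mk₂ k (fun m f => (LinearMap.mulLeft k m).compMultilinearMap f)
    (by intro m m' f; ext a; simp [add_mul]) (by intro c m f; ext a; simp)
    (by intro m f f'; ext a; simp) (by intro c m f; ext a; simp)

theorem mulCochain_apply (n : ℕ) (m : M) (f : Cochain k A M n) (a : Fin n → A) :
    mulCochain n m f a = m * f a := rfl

/-- The cup product of a `1`-cochain and an `n`-cochain, placed in degree `n + 1` instead of the
degree `1 + n` that `cup` yields. -/
def consCochain (n : ℕ) :
    (A →ₗ[k] M) →ₗ[k] Cochain k A M n →ₗ[k] Cochain k A M (n + 1) :=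
  LinearMap.mk₂ k (fun h f => ((mulCochain n).flip f ∘ₗ h).uncurryLeft)
    (by intro m m' f; ext a; simp) (by intro c m f; ext a; simp)
    (by intro m f f'; ext a; simp) (by intro c m f; ext a; simp)

theorem consCochain_apply (n : ℕ) (h : A →ₗ[k] M) (f : Cochain k A M n) (a : Fin (n + 1) → A) :
    consCochain n h f a = h (a 0) * f (fun i => a i.succ) := rfl

section Differential

variable [Module A M] [Module Aᵐᵒᵖ M] [IsScalarTower k A M] [IsScalarTower k Aᵐᵒᵖ M]

theorem d_apply_seq (n : ℕ) (f : Cochain k A M n) (a : ℕ → A) :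
    d n f (fun j => a j) =
      ∑ i ∈ Finset.range (n + 2), (-1 : k) ^ i • faceSeq n i (fun b => f fun j => b j) a := by
  have hmiddle (i : Fin n) : faceSeq n (i + 1) (fun b => f fun j => b j) a =
      f (Fin.contractNth i.castSucc (· * ·) fun j : Fin (n + 1) => a j) :=
    faceSeq_succ n _ a i.2.ne
  rw [d_apply, Finset.sum_range_succ, Finset.sum_range_succ', Finset.sum_range]
  simp only [hmiddle, faceSeq_zero, faceSeq_last, pow_zero, one_smul, Fin.val_succ,
    Fin.val_castSucc, Fin.val_last, Fin.val_zero]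
  abel

theorem d_d [SMulCommClass A Aᵐᵒᵖ M] (n : ℕ) (f : Cochain k A M n) : d (n + 1) (d n f) = 0 := by
  ext a
  obtain ⟨b, rfl⟩ : ∃ b : ℕ → A, a = fun j : Fin (n + 1 + 1) => b j :=
    ⟨fun j => if hj : j < n + 1 + 1 then a ⟨j, hj⟩ else 0, by funext j; simp [j.2]⟩
  simp only [d_apply_seq, faceSeq_sum_smul]
  exact sum_sum_neg_one_pow_eq_zero _ (n + 2) fun i j hij hj =>
    faceSeq_faceSeq b hij hj fun a b hab => congrArg f (funext fun l => hab l l.2)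

variable (k A) in
/-- The inner derivation `φ_m(a) = a m - m a`. -/
def innerDer (m : M) : A →ₗ[k] M where
  toFun a := a • m - op a • m
  map_add' a b := by simp only [add_smul, op_add]; abel
  map_smul' c a := by simp [smul_sub]

theorem innerDer_apply (m : M) (a : A) : innerDer k A m a = a • m - op a • m := rfl

theorem d_mulCochain
    (h₁ : ∀ (a : A) (x y : M), (a • x) * y = a • (x * y))
    (h₂ : ∀ (a : A) (x y : M), x * (op a • y) = op a • (x * y))
    (h₃ : ∀ (a : A) (x y : M), (op a • x) * y = x * (a • y))
    (n : ℕ) (m : M) (f : Cochain k A M n) :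
    d n (mulCochain n m f) = mulCochain (n + 1) m (d n f) + consCochain n (innerDer k A m) f := by
  ext a
  simp only [add_apply, d_apply, mulCochain_apply, consCochain_apply,
    innerDer_apply, mul_add, sub_mul, h₁, h₃, Finset.mul_sum, mul_smul_comm, h₂]
  abel

theorem d_consCochain
    (h₁ : ∀ (a : A) (x y : M), (a • x) * y = a • (x * y))
    (h₂ : ∀ (a : A) (x y : M), x * (op a • y) = op a • (x * y))
    (h₃ : ∀ (a : A) (x y : M), (op a • x) * y = x * (a • y))
    (n : ℕ) (h : A →ₗ[k] M) (hder : ∀ a b, h (a * b) = a • h b + op b • h a)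
    (f : Cochain k A M n) :
    d (n + 1) (consCochain n h f) = -consCochain (n + 1) h (d n f) := by
  ext a
  have tail_contract_succ (i : Fin n) :
      (fun j : Fin n => Fin.contractNth (Fin.castSucc i.succ) (· * ·) a j.succ) =
        Fin.contractNth i.castSucc (· * ·) (fun j => a j.succ) := by
    funext j
    simp only [Fin.contractNth, Fin.val_castSucc, Fin.val_succ, Nat.add_lt_add_iff_right,
      Nat.add_right_cancel_iff]
    rfl
  have tail_contract_zero :
      (fun j : Fin n => Fin.contractNth (0 : Fin (n + 2)) (· * ·) a j.succ) =
        fun j => a j.succ.succ := by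
    funext j
    simp [Fin.contractNth]
  have head_contract_zero : Fin.contractNth (0 : Fin (n + 2)) (· * ·) a 0 = a 0 * a 1 := by
    simp [Fin.contractNth]
  have head_contract_succ (i : Fin n) :
      Fin.contractNth (Fin.castSucc i.succ) (· * ·) a 0 = a 0 := by
    simp [Fin.contractNth]
  simp only [neg_apply, d_apply, consCochain_apply, Fin.sum_univ_succ, tail_contract_succ,
    tail_contract_zero, head_contract_zero, head_contract_succ, hder, add_mul, mul_add, h₁, h₂, h₃,
    Finset.mul_sum, mul_smul_comm, Fin.val_zero, Fin.val_succ, pow_succ, mul_neg, mul_one, neg_neg,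
    neg_smul, one_smul, pow_zero, Finset.sum_neg_distrib, neg_add_rev, smul_add,
    Fin.succ_zero_eq_one, Fin.castSucc_zero, Fin.succ_last, Fin.succ_castSucc]
  abel

end Differential

variable [Group G] [MulSemiringAction G A] [SMulCommClass G k A]
  [MulSemiringAction G M] [SMulCommClass G k M]

variable (k A M G) in
/-- The representation of `G` on `C^n(A, M)`. -/
def cochainRep (n : ℕ) : Representation k G (Cochain k A M n) where
  toFun g := act g n
  map_one' := by ext f a; simp [act_apply]
  map_mul' g g' := by ext f a; simp [act_apply, mul_smul]

variable (k A M) in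
/-- `C^n(A, M)^H` for a subgroup `H`. -/
noncomputable abbrev fixedCochain (H : Subgroup G) (n : ℕ) : Submodule k (Cochain k A M n) :=
  fixed (cochainRep k A M G n) H

/-- The operator `Δ_ρ = 1 - ρ` on cochains. -/
abbrev deltaCochain (ρ : G) (n : ℕ) : Module.End k (Cochain k A M n) :=
  delta (cochainRep k A M G n) ρ

theorem cochainRep_apply (g : G) (n : ℕ) (f : Cochain k A M n) :
    cochainRep k A M G n g f = act g n f := rfl

theorem invCochain_eq_fixedCochain_top (n : ℕ) :
    invCochain k A M G n = fixedCochain k A M (⊤ : Subgroup G) n :=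
  Submodule.ext fun _ => ⟨fun h => mem_fixed_iff.2 fun g _ => h g, fun h g => h ⟨g, trivial⟩⟩

theorem invCochain_le_fixedCochain (H : Subgroup G) (n : ℕ) :
    invCochain k A M G n ≤ fixedCochain k A M H n := fun _ hf =>
  mem_fixed_iff.2 fun g _ => hf g

theorem act_mulCochain (g : G) (n : ℕ) (m : M) (f : Cochain k A M n) :
    act g n (mulCochain n m f) = mulCochain n (g • m) (act g n f) := by
  ext a
  simp [act_apply, mulCochain_apply, smul_mul']

variable (k) in
/-- The action of `g` on linear maps `A → M`, that is, on `1`-cochains. -/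
def actLinearMap (g : G) (h : A →ₗ[k] M) : A →ₗ[k] M :=
  DistribSMul.toLinearMap k M g ∘ₗ h ∘ₗ DistribSMul.toLinearMap k A g⁻¹

theorem actLinearMap_apply (g : G) (h : A →ₗ[k] M) (a : A) :
    actLinearMap k g h a = g • h (g⁻¹ • a) := rfl

theorem act_consCochain (g : G) (n : ℕ) (h : A →ₗ[k] M) (f : Cochain k A M n) :
    act g (n + 1) (consCochain n h f) = consCochain n (actLinearMap k g h) (act g n f) := by
  ext a
  simp [act_apply, consCochain_apply, actLinearMap_apply, smul_mul']

variable {H : Subgroup G} {ρ : G} {n l : ℕ} {f : Cochain k A M n} {g : Cochain k A M l}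

theorem mulCochain_mem_fixedCochain {m : M} (hm : ∀ g ∈ H, g • m = m)
    (hf : f ∈ fixedCochain k A M H n) : mulCochain n m f ∈ fixedCochain k A M H n :=
  mem_fixed_iff.2 fun g hg => by
    rw [cochainRep_apply, act_mulCochain, hm g hg, ← cochainRep_apply, mem_fixed_iff.1 hf g hg]

theorem consCochain_mem_fixedCochain {h : A →ₗ[k] M} (hh : ∀ g ∈ H, actLinearMap k g h = h)
    (hf : f ∈ fixedCochain k A M H n) : consCochain n h f ∈ fixedCochain k A M H (n + 1) :=
  mem_fixed_iff.2 fun g hg => by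
    rw [cochainRep_apply, act_consCochain, hh g hg, ← cochainRep_apply, mem_fixed_iff.1 hf g hg]

theorem cup_mem_fixedCochain (hf : f ∈ fixedCochain k A M H n) (hg : g ∈ fixedCochain k A M H l) :
    cup n l f g ∈ fixedCochain k A M H (n + l) :=
  mem_fixed_iff.2 fun α hα => by
    rw [cochainRep_apply, act_cup, ← cochainRep_apply, ← cochainRep_apply, mem_fixed_iff.1 hf α hα,
      mem_fixed_iff.1 hg α hα]

theorem deltaCochain_pow_cup_right (j : ℕ) (hf : act ρ n f = f) :
    (deltaCochain ρ (n + l) ^ j) (cup n l f g) = cup n l f ((deltaCochain ρ l ^ j) g) :=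
  (map_delta_pow (φ := cup n l f) (fun g => by
    rw [cochainRep_apply, cochainRep_apply, act_cup, hf]) j g).symm

theorem deltaCochain_pow_cup_left (j : ℕ) (hg : act ρ l g = g) :
    (deltaCochain ρ (n + l) ^ j) (cup n l f g) = cup n l ((deltaCochain ρ n ^ j) f) g :=
  (map_delta_pow (φ := (cup n l).flip g) (fun f => by
    rw [cochainRep_apply, cochainRep_apply, LinearMap.flip_apply, LinearMap.flip_apply, act_cup,
      hg]) j f).symm

end Cochains

section Boundaries

variable {k A M G : Type*} [Field k] [Ring A] [Algebra k A] [Ring M] [Algebra k M]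
  [Module A M] [Module Aᵐᵒᵖ M] [IsScalarTower k A M] [IsScalarTower k Aᵐᵒᵖ M]

theorem map_mem_boundaries {S T : ∀ n, Submodule k (Cochain k A M n)}
    {φ : ∀ n, Module.End k (Cochain k A M n)} (hd : ∀ n f, d n (φ n f) = φ (n + 1) (d n f))
    (hφ : ∀ n, ∀ f ∈ S n, φ n f ∈ T n) {n : ℕ} {f : Cochain k A M n} (hf : f ∈ boundaries S n) :
    φ n f ∈ boundaries T n := by
  cases n with
  | zero =>
    obtain rfl : f = 0 := hf
    exact map_zero (φ 0)
  | succ n =>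
    obtain ⟨t, ht, rfl⟩ := hf
    exact ⟨φ n t, hφ n t ht, hd n t⟩

theorem boundaries_mono {S T : ∀ n, Submodule k (Cochain k A M n)} (hST : ∀ n, S n ≤ T n) (n : ℕ) :
    boundaries S n ≤ boundaries T n := fun _ hf =>
  map_mem_boundaries (φ := fun _ => 1) (fun _ _ => rfl) (fun n _ hf => hST n hf) hf

variable [SMulCommClass A Aᵐᵒᵖ M] [Group G] [MulSemiringAction G A] [SMulCommClass G k A]
  [MulSemiringAction G M] [SMulCommClass G k M]

variable (k A M) in
/-- The cocycles of the subcomplex `C(A, M)^H`. -/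
noncomputable abbrev fixedCocycles (H : Subgroup G) (n : ℕ) : Submodule k (Cochain k A M n) :=
  cocycles k A M n ⊓ fixedCochain k A M H n

variable [hM : IsAeGModuleAlgebra k A M G] {H : Subgroup G} {ρ : G} {n l : ℕ}
  {f : Cochain k A M n} {g : Cochain k A M l}

theorem d_deltaCochain_pow (j : ℕ) (f : Cochain k A M n) :
    d n ((deltaCochain ρ n ^ j) f) = (deltaCochain ρ (n + 1) ^ j) (d n f) :=
  map_delta_pow (τ := cochainRep k A M G n) (σ := cochainRep k A M G (n + 1)) (d_act ρ n) j f

theorem d_mem_fixedCochain (hf : f ∈ fixedCochain k A M H n) :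
    d n f ∈ fixedCochain k A M H (n + 1) :=
  mem_fixed_iff.2 fun g hg => by
    rw [cochainRep_apply, ← d_act, ← cochainRep_apply, mem_fixed_iff.1 hf g hg]

theorem boundaries_le_cocycles {S : ∀ n, Submodule k (Cochain k A M n)} :
    boundaries S n ≤ cocycles k A M n := by
  cases n with
  | zero => exact bot_le
  | succ n =>
    rintro _ ⟨t, -, rfl⟩
    exact d_d n t

theorem boundaries_le_fixedCochain :
    boundaries (fixedCochain k A M H) n ≤ fixedCochain k A M H n := by
  cases n with
  | zero => exact bot_le
  | succ n =>
    rintro _ ⟨t, ht, rfl⟩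
    exact d_mem_fixedCochain ht

theorem boundaries_le_fixedCocycles :
    boundaries (fixedCochain k A M H) n ≤ fixedCocycles k A M H n :=
  le_inf boundaries_le_cocycles boundaries_le_fixedCochain

theorem deltaCochain_pow_mem_boundaries [H.Normal] (j : ℕ)
    (hf : f ∈ boundaries (fixedCochain k A M H) n) :
    (deltaCochain ρ n ^ j) f ∈ boundaries (fixedCochain k A M H) n :=
  map_mem_boundaries (fun _ => d_deltaCochain_pow j) (fun _ _ => delta_pow_mem_fixed j) hf

theorem deltaCochain_pow_mem_fixedCocycles [H.Normal] (j : ℕ) (hf : f ∈ fixedCocycles k A M H n) :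
    (deltaCochain ρ n ^ j) f ∈ fixedCocycles k A M H n :=
  ⟨LinearMap.mem_ker.2 (by rw [d_deltaCochain_pow, LinearMap.mem_ker.1 hf.1, map_zero]),
    delta_pow_mem_fixed j hf.2⟩

theorem mem_boundaries_fixedCochain (hH : (Nat.card H : k) ≠ 0) (hf : f ∈ fixedCochain k A M H n)
    (hfb : f ∈ boundaries (fun _ => ⊤) n) : f ∈ boundaries (fixedCochain k A M H) n := by
  cases n with
  | zero => exact hfb
  | succ n =>
    obtain ⟨t, -, rfl⟩ := hfb
    obtain ⟨s, hs, hst⟩ := exists_mem_fixed_sub_mem (τ := cochainRep k A M G n)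
      (S := LinearMap.ker (d n)) (v := t) hH fun g hg => by
        rw [LinearMap.mem_ker, map_sub, sub_eq_zero, cochainRep_apply, d_act]
        exact mem_fixed_iff.1 hf g hg
    exact ⟨s, hs, sub_eq_zero.1 ((map_sub _ _ _).symm.trans hst)⟩

theorem cup_mem_fixedCocycles (hf : f ∈ fixedCocycles k A M H n)
    (hg : g ∈ fixedCocycles k A M H l) : cup n l f g ∈ fixedCocycles k A M H (n + l) :=
  ⟨cup_mem_cocycles hM.smul_mul hM.mul_op_smul hM.op_smul_mul hf.1 hg.1,
    cup_mem_fixedCochain hf.2 hg.2⟩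

theorem cup_mem_boundaries_fixedCochain_left (hf : f ∈ boundaries (fixedCochain k A M H) n)
    (hg : g ∈ fixedCocycles k A M H l) :
    cup n l f g ∈ boundaries (fixedCochain k A M H) (n + l) :=
  cup_mem_boundaries_left hM.smul_mul hM.mul_op_smul hM.op_smul_mul
    (fun _ _ ht => cup_mem_fixedCochain ht hg.2) hf hg.1

theorem cup_mem_boundaries_fixedCochain_right (hf : f ∈ fixedCocycles k A M H n)
    (hg : g ∈ boundaries (fixedCochain k A M H) l) :
    cup n l f g ∈ boundaries (fixedCochain k A M H) (n + l) :=
  cup_mem_boundaries_right hM.smul_mul hM.mul_op_smul hM.op_smul_mul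
    (fun _ _ ht => cup_mem_fixedCochain hf.2 ht) hf.1 hg

end Boundaries

section TwistedExtension

variable {k A M G : Type*} [Field k] [Ring A] [Algebra k A] [Ring M] [Algebra k M]
  [Group G] [MulSemiringAction G A] [SMulCommClass G k A]
  [MulSemiringAction G M] [SMulCommClass G k M]

/-- The automorphism of `C^n ⊕ C^n` that lifts the action of `ρ` on both summands and is twisted
by `m`. -/
def twistedAct (ρ : G) (m : M) (n : ℕ) : Module.End k (Cochain k A M n × Cochain k A M n) :=
  LinearMap.prod (act ρ n ∘ₗ LinearMap.fst k _ _ +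
    mulCochain n m ∘ₗ act ρ n ∘ₗ LinearMap.snd k _ _) (act ρ n ∘ₗ LinearMap.snd k _ _)

theorem twistedAct_apply (ρ : G) (m : M) (n : ℕ) (u v : Cochain k A M n) :
    twistedAct ρ m n (u, v) = (act ρ n u + mulCochain n m (act ρ n v), act ρ n v) := rfl

theorem twistedAct_pow_apply (ρ : G) (m : M) (n j : ℕ) (u v : Cochain k A M n) :
    (twistedAct ρ m n ^ j) (u, v) =
      (act (ρ ^ j) n u + mulCochain n (∑ a ∈ Finset.range j, ρ ^ a • m) (act (ρ ^ j) n v),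
        act (ρ ^ j) n v) := by
  induction j with
  | zero => simp [← cochainRep_apply]
  | succ j ih =>
    have hact (f : Cochain k A M n) : act ρ n (act (ρ ^ j) n f) = act (ρ ^ (j + 1)) n f := by
      simp only [← cochainRep_apply, pow_succ', map_mul, Module.End.mul_apply]
    rw [pow_succ', Module.End.mul_apply, ih, twistedAct_apply, map_add, act_mulCochain, hact, hact,
      add_assoc, ← LinearMap.add_apply, ← map_add, Finset.sum_range_succ' _ j, Finset.smul_sum]
    simp [pow_succ', mul_smul]

/-- The operator `1 - ρ` on the extension `C^n ⊕ C^n` twisted by `m`. -/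
def twistedDelta (ρ : G) (m : M) (n : ℕ) : Module.End k (Cochain k A M n × Cochain k A M n) :=
  1 - twistedAct ρ m n

theorem twistedDelta_apply (ρ : G) (m : M) (n : ℕ) (u v : Cochain k A M n) :
    twistedDelta ρ m n (u, v) =
      (deltaCochain ρ n u - mulCochain n m (act ρ n v), deltaCochain ρ n v) := by
  rw [twistedDelta, LinearMap.sub_apply, twistedAct_apply, delta_apply, delta_apply, sub_sub]
  rfl

theorem snd_twistedDelta_pow (ρ : G) (m : M) (n j : ℕ) (x : Cochain k A M n × Cochain k A M n) :
    ((twistedDelta ρ m n ^ j) x).2 = (deltaCochain ρ n ^ j) x.2 :=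
  map_pow_apply (φ := LinearMap.snd k _ _)
    (fun x => congrArg Prod.snd (twistedDelta_apply ρ m n x.1 x.2)) j x

theorem twistedDelta_pow_mem {H : Subgroup G} [H.Normal] {ρ : G} {m : M} (hm : ∀ g ∈ H, g • m = m)
    {n : ℕ} (j : ℕ) {x : Cochain k A M n × Cochain k A M n}
    (hx : x ∈ (fixedCochain k A M H n).prod (fixedCochain k A M H n)) :
    (twistedDelta ρ m n ^ j) x ∈ (fixedCochain k A M H n).prod (fixedCochain k A M H n) := by
  refine Module.End.pow_apply_mem_of_forall_mem j (fun y hy => ?_) x hx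
  rw [← Prod.mk.eta (p := y), twistedDelta_apply]
  exact ⟨Submodule.sub_mem _ (delta_mem_fixed hy.1)
    (mulCochain_mem_fixedCochain hm (Representation.le_comap_invariants _ H ρ hy.2)),
    delta_mem_fixed hy.2⟩

variable [Module A M] [Module Aᵐᵒᵖ M] [IsScalarTower k A M] [IsScalarTower k Aᵐᵒᵖ M]

/-- The differential of the extension `C ⊕ C` twisted by the derivation `h`. -/
def twistedD (h : A →ₗ[k] M) (n : ℕ) :
    Cochain k A M n × Cochain k A M n →ₗ[k] Cochain k A M (n + 1) × Cochain k A M (n + 1) :=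
  LinearMap.prod (d n ∘ₗ LinearMap.fst k _ _ + consCochain n h ∘ₗ LinearMap.snd k _ _)
    (d n ∘ₗ LinearMap.snd k _ _)

theorem twistedD_apply (h : A →ₗ[k] M) (n : ℕ) (u v : Cochain k A M n) :
    twistedD h n (u, v) = (d n u + consCochain n h v, d n v) := rfl

theorem twistedD_mem [SMulCommClass A Aᵐᵒᵖ M] [IsAeGModuleAlgebra k A M G] {H : Subgroup G}
    {h : A →ₗ[k] M} (hh : ∀ g ∈ H, actLinearMap k g h = h)
    {n : ℕ} {x : Cochain k A M n × Cochain k A M n}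
    (hx : x ∈ (fixedCochain k A M H n).prod (fixedCochain k A M H n)) :
    twistedD h n x ∈ (fixedCochain k A M H (n + 1)).prod (fixedCochain k A M H (n + 1)) :=
  ⟨Submodule.add_mem _ (d_mem_fixedCochain hx.1) (consCochain_mem_fixedCochain hh hx.2),
    d_mem_fixedCochain hx.2⟩

end TwistedExtension

section DeltaExact

variable {k A M G : Type*} [Field k] [Ring A] [Algebra k A] [Ring M] [Algebra k M]
  [Module A M] [Module Aᵐᵒᵖ M] [IsScalarTower k A M] [IsScalarTower k Aᵐᵒᵖ M]
  [Group G] [MulSemiringAction G A] [SMulCommClass G k A]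
  [MulSemiringAction G M] [SMulCommClass G k M]

variable (k A M) in
/-- The properties of the operator `Δ_ρ` on the complex `C(A, M)^H` that the comparison of `X` and
`Y` rests on: `G` is generated by `H` and `ρ`, `Δ_ρ^q = 0`, the kernel of `Δ_ρ^a` is the image of
`Δ_ρ^(q-a)`, and a coboundary divisible by `Δ_ρ^j` is `Δ_ρ^j` of a cocycle. -/
structure IsDeltaExact (H : Subgroup G) (ρ : G) (q : ℕ) : Prop where
  pos : 0 < q
  sup_zpowers : H ⊔ Subgroup.zpowers ρ = ⊤
  pow_eq_zero : ∀ {n : ℕ} {f : Cochain k A M n}, f ∈ fixedCochain k A M H n →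
    (deltaCochain ρ n ^ q) f = 0
  exists_pow_eq : ∀ {n a : ℕ} {f : Cochain k A M n}, a ≤ q → f ∈ fixedCochain k A M H n →
    (deltaCochain ρ n ^ a) f = 0 →
      ∃ g ∈ fixedCochain k A M H n, (deltaCochain ρ n ^ (q - a)) g = f
  exists_cocycle_pow_eq : ∀ {n j : ℕ} {f : Cochain k A M n}, j ≤ q → f ∈ fixedCochain k A M H n →
    (deltaCochain ρ n ^ j) f ∈ boundaries (fixedCochain k A M H) n →
      ∃ g ∈ fixedCocycles k A M H n, (deltaCochain ρ n ^ j) g = (deltaCochain ρ n ^ j) f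

end DeltaExact

section Degenerated

variable {k A M G : Type*} [Field k] [Ring A] [Algebra k A] [Ring M] [Algebra k M]
  [Module A M] [Module Aᵐᵒᵖ M] [Group G] [MulSemiringAction G A]
  [MulSemiringAction G M] [SMulCommClass G k M]

namespace IsDegenerated

variable {H : Subgroup G} {ρ : G} {m : M} {h : A →ₗ[k] M}

section Norm

variable {p e : ℕ} [Fact p.Prime] [CharP k p]

theorem sum_range_smul (D : IsDegenerated H ρ (p ^ e) m h) :
    ∑ a ∈ Finset.range (p ^ e), ρ ^ a • m = 1 :=
  (delta_pow_char_pow_sub_one_apply (τ := Representation.ofDistribMulAction k G M) p e m).symm.trans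
    D.norm_m

variable [SMulCommClass G k A]

theorem deltaCochain_pow_mulCochain (D : IsDegenerated H ρ (p ^ e) m h) {n : ℕ}
    {f : Cochain k A M n} (hf : f ∈ invCochain k A M G n) :
    (deltaCochain ρ n ^ (p ^ e - 1)) (mulCochain n m f) = f := by
  have hact (g : G) : act g n (mulCochain n m f) = mulCochain n (g • m) f := by
    rw [act_mulCochain, hf g]
  rw [delta_pow_char_pow_sub_one_apply p]
  simp only [cochainRep_apply, hact]
  rw [← LinearMap.sum_apply, ← map_sum, D.sum_range_smul]
  ext a
  exact one_mul (f a)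

theorem twistedDelta_pow_char_pow (D : IsDegenerated H ρ (p ^ e) m h) (hρ : ρ ^ p ^ e ∈ H) {n : ℕ}
    {x : Cochain k A M n × Cochain k A M n}
    (hx : x ∈ (fixedCochain k A M H n).prod (fixedCochain k A M H n)) :
    (twistedDelta ρ m n ^ p ^ e) x = (-x.2, 0) := by
  obtain ⟨u, v⟩ := x
  have hu : act (ρ ^ p ^ e) n u = u := mem_fixed_iff.1 hx.1 _ hρ
  have hv : act (ρ ^ p ^ e) n v = v := mem_fixed_iff.1 hx.2 _ hρ
  rw [twistedDelta, one_sub_pow_char_pow k p e (twistedAct ρ m n), LinearMap.sub_apply,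
    twistedAct_pow_apply, D.sum_range_smul, hu, hv]
  refine Prod.ext ?_ (sub_self v)
  ext a
  simp [mulCochain_apply]

end Norm

variable [SMulCommClass G k A]

theorem actLinearMap_eq_self {q : ℕ} (D : IsDegenerated H ρ q m h) (g : G) (hg : g ∈ H) :
    actLinearMap k g h = h :=
  LinearMap.ext (D.h_inv g hg)

variable [IsScalarTower k A M] [IsScalarTower k Aᵐᵒᵖ M]

theorem actLinearMap_eq {q : ℕ} (D : IsDegenerated H ρ q m h) :
    actLinearMap k ρ h = h + innerDer k A m := by
  ext a
  have ha := D.delta_h a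
  rw [sub_add_eq_add_sub, sub_eq_zero] at ha
  exact ha.symm

variable [SMulCommClass A Aᵐᵒᵖ M] [hM : IsAeGModuleAlgebra k A M G]

theorem twistedD_twistedDelta_pow {q : ℕ} (D : IsDegenerated H ρ q m h) (n j : ℕ)
    (x : Cochain k A M n × Cochain k A M n) :
    twistedD h n ((twistedDelta ρ m n ^ j) x) =
      (twistedDelta ρ m (n + 1) ^ j) (twistedD h n x) := by
  refine map_pow_apply (fun ⟨u, v⟩ => ?_) j x
  simp only [twistedDelta_apply, twistedD_apply, delta_apply, cochainRep_apply, map_sub, map_add,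
    d_act, act_consCochain, D.actLinearMap_eq, LinearMap.add_apply,
    d_mulCochain hM.smul_mul hM.mul_op_smul hM.op_smul_mul]
  refine Prod.ext ?_ rfl
  dsimp only
  abel

theorem twistedD_twistedD {q : ℕ} (D : IsDegenerated H ρ q m h) (n : ℕ)
    (x : Cochain k A M n × Cochain k A M n) : twistedD h (n + 1) (twistedD h n x) = 0 := by
  obtain ⟨u, v⟩ := x
  rw [twistedD_apply, twistedD_apply, map_add, d_d, d_d, zero_add,
    d_consCochain hM.smul_mul hM.mul_op_smul hM.op_smul_mul n h D.h_der, neg_add_cancel,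
    Prod.mk_zero_zero]

variable {p e : ℕ} [Fact p.Prime] [CharP k p] [H.Normal]

-- With `T^j (0, w) = (s, d z)`, the correction `T^(q-j) (0, s - h z)` of `(0, w)` is chosen so that
-- `T^j b = D (0, z)`. As `T^q (u, v) = (-v, 0)`, the equation `T^q D b = 0` says `d b.2 = 0`.
theorem exists_cocycle_deltaCochain_pow_eq (D : IsDegenerated H ρ (p ^ e) m h)
    (hρ : ρ ^ p ^ e ∈ H) {n j : ℕ} (hj : j ≤ p ^ e) {z : Cochain k A M n}
    (hz : z ∈ fixedCochain k A M H n) {w : Cochain k A M (n + 1)}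
    (hw : w ∈ fixedCochain k A M H (n + 1)) (hzw : d n z = (deltaCochain ρ (n + 1) ^ j) w) :
    ∃ w' ∈ fixedCocycles k A M H (n + 1), (deltaCochain ρ (n + 1) ^ j) w' = d n z := by
  set W := fixedCochain k A M H (n + 1)
  set T := twistedDelta (k := k) (A := A) ρ m (n + 1)
  have hTw : (T ^ j) (0, w) ∈ W.prod W := twistedDelta_pow_mem D.m_inv j ⟨W.zero_mem, hw⟩
  obtain ⟨s, hs⟩ : ∃ s, (T ^ j) (0, w) = (s, d n z) :=
    ⟨_, Prod.ext rfl ((snd_twistedDelta_pow ρ m _ j _).trans hzw.symm)⟩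
  rw [hs] at hTw
  have hy : (0, s - consCochain n h z) ∈ W.prod W :=
    ⟨W.zero_mem, W.sub_mem hTw.1 (consCochain_mem_fixedCochain D.actLinearMap_eq_self hz)⟩
  set b := (0, w) + (T ^ (p ^ e - j)) (0, s - consCochain n h z) with hb
  have hbW : b ∈ W.prod W :=
    Submodule.add_mem _ ⟨W.zero_mem, hw⟩ (twistedDelta_pow_mem D.m_inv _ hy)
  have hTb : (T ^ j) b = twistedD h n (0, z) := by
    rw [hb, map_add, hs, ← Module.End.mul_apply, ← pow_add, Nat.add_sub_cancel' hj,
      D.twistedDelta_pow_char_pow hρ hy, twistedD_apply]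
    simp
  have hTD : (twistedDelta ρ m (n + 1 + 1) ^ p ^ e) (twistedD h (n + 1) b) = 0 := by
    rw [← Nat.sub_add_cancel hj, pow_add, Module.End.mul_apply, ← D.twistedD_twistedDelta_pow,
      hTb, D.twistedD_twistedD n, map_zero]
  rw [D.twistedDelta_pow_char_pow hρ (twistedD_mem D.actLinearMap_eq_self hbW)] at hTD
  refine ⟨b.2, ⟨neg_eq_zero.1 (congrArg Prod.fst hTD), hbW.2⟩, ?_⟩
  rw [← snd_twistedDelta_pow ρ m, hTb]
  rfl

theorem isDeltaExact (D : IsDegenerated H ρ (p ^ e) m h) (hgen : H ⊔ Subgroup.zpowers ρ = ⊤)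
    (hρ : ρ ^ p ^ e ∈ H) : IsDeltaExact k A M H ρ (p ^ e) where
  pos := pow_pos (Fact.out : p.Prime).pos e
  sup_zpowers := hgen
  pow_eq_zero := delta_pow_char_pow_eq_zero p hρ
  exists_pow_eq {n a f} ha hf hfa := by
    refine exists_pow_apply_eq_of_pow_apply_eq_zero (fun _ => delta_mem_fixed) (fun f hf hf₀ => ?_)
      ha hf hfa
    refine ⟨mulCochain _ m f, mulCochain_mem_fixedCochain D.m_inv hf,
      D.deltaCochain_pow_mulCochain ?_⟩
    rw [invCochain_eq_fixedCochain_top]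
    exact (mem_fixed_top_iff hgen).2 ⟨hf, hf₀⟩
  exists_cocycle_pow_eq {n j f} hj hf hb := by
    cases n with
    | zero => exact ⟨0, Submodule.zero_mem _, (map_zero _).trans (Eq.symm hb)⟩
    | succ n =>
      obtain ⟨z, hz, hzf⟩ := hb
      obtain ⟨g, hg, hgz⟩ := D.exists_cocycle_deltaCochain_pow_eq hρ hj hz hf hzf
      exact ⟨g, hg, hgz.trans hzf⟩

end IsDegenerated

end Degenerated

section Invariants

variable {k A M G : Type*} [Field k] [Ring A] [Algebra k A] [Ring M] [Algebra k M]
  [Module A M] [Module Aᵐᵒᵖ M] [IsScalarTower k A M] [IsScalarTower k Aᵐᵒᵖ M]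
  [Group G] [MulSemiringAction G A] [SMulCommClass G k A]
  [MulSemiringAction G M] [SMulCommClass G k M]
  {H : Subgroup G} {ρ : G} {q l n r : ℕ} {f w : Cochain k A M n} {g : Cochain k A M r}

variable (k A M) in
/-- The filtration of the coboundaries of `C(A, M)^H` by the images of the powers of `Δ_ρ`. -/
noncomputable abbrev deltaBoundaries (H : Subgroup G) (ρ : G) (l n : ℕ) :
    Submodule k (Cochain k A M n) :=
  (boundaries (fixedCochain k A M H) n).map (deltaCochain ρ n ^ l)

variable (k A M) in
/-- The cocycles of `C(A, M)^H` whose classes are killed by `Δ_ρ^j`. -/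
noncomputable abbrev torsionCocycles (H : Subgroup G) (ρ : G) (j n : ℕ) :
    Submodule k (Cochain k A M n) :=
  fixedCocycles k A M H n ⊓ (boundaries (fixedCochain k A M H) n).comap (deltaCochain ρ n ^ j)

variable [SMulCommClass A Aᵐᵒᵖ M] [hM : IsAeGModuleAlgebra k A M G]

theorem antitone_deltaBoundaries [H.Normal] (n : ℕ) :
    Antitone fun l => deltaBoundaries k A M H ρ l n := by
  refine antitone_nat_of_succ_le fun l => ?_
  rintro _ ⟨y, hy, rfl⟩
  exact ⟨_, deltaCochain_pow_mem_boundaries 1 hy, pow_apply_pow_apply rfl y⟩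

theorem cup_mem_deltaBoundaries_left (hf : f ∈ deltaBoundaries k A M H ρ l n)
    (hg : g ∈ cocycles k A M r ⊓ invCochain k A M G r) :
    cup n r f g ∈ deltaBoundaries k A M H ρ l (n + r) := by
  obtain ⟨y, hy, rfl⟩ := hf
  exact ⟨cup n r y g, cup_mem_boundaries_fixedCochain_left hy
    ⟨hg.1, invCochain_le_fixedCochain H r hg.2⟩, deltaCochain_pow_cup_left l (hg.2 ρ)⟩

theorem cup_mem_deltaBoundaries_right (hf : f ∈ cocycles k A M n ⊓ invCochain k A M G n)
    (hg : g ∈ deltaBoundaries k A M H ρ l r) :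
    cup n r f g ∈ deltaBoundaries k A M H ρ l (n + r) := by
  obtain ⟨y, hy, rfl⟩ := hg
  exact ⟨cup n r f y, cup_mem_boundaries_fixedCochain_right
    ⟨hf.1, invCochain_le_fixedCochain H n hf.2⟩ hy, deltaCochain_pow_cup_right l (hf.2 ρ)⟩

theorem deltaCochain_pow_mem_boundaries_of_le [H.Normal] {j : ℕ} (hjl : j ≤ l)
    (hw : w ∈ torsionCocycles k A M H ρ j n) :
    (deltaCochain ρ n ^ l) w ∈ boundaries (fixedCochain k A M H) n := by
  rw [← pow_apply_pow_apply (Nat.sub_add_cancel hjl)]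
  exact deltaCochain_pow_mem_boundaries _ hw.2

theorem cup_mem_torsionCocycles_left (hf : f ∈ torsionCocycles k A M H ρ l n)
    (hg : g ∈ cocycles k A M r ⊓ invCochain k A M G r) :
    cup n r f g ∈ torsionCocycles k A M H ρ l (n + r) := by
  have hgH : g ∈ fixedCocycles k A M H r := ⟨hg.1, invCochain_le_fixedCochain H r hg.2⟩
  refine ⟨cup_mem_fixedCocycles hf.1 hgH, ?_⟩
  rw [SetLike.mem_coe, Submodule.mem_comap, deltaCochain_pow_cup_left l (hg.2 ρ)]
  exact cup_mem_boundaries_fixedCochain_left hf.2 hgH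

theorem cup_mem_torsionCocycles_right (hf : f ∈ cocycles k A M n ⊓ invCochain k A M G n)
    (hg : g ∈ torsionCocycles k A M H ρ l r) :
    cup n r f g ∈ torsionCocycles k A M H ρ l (n + r) := by
  have hfH : f ∈ fixedCocycles k A M H n := ⟨hf.1, invCochain_le_fixedCochain H n hf.2⟩
  refine ⟨cup_mem_fixedCocycles hfH hg.1, ?_⟩
  rw [SetLike.mem_coe, Submodule.mem_comap, deltaCochain_pow_cup_right l (hf.2 ρ)]
  exact cup_mem_boundaries_fixedCochain_right hfH hg.2

namespace IsDeltaExact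

omit [SMulCommClass A Aᵐᵒᵖ M] hM in
theorem mem_invCochain_iff (E : IsDeltaExact k A M H ρ q) :
    f ∈ invCochain k A M G n ↔ f ∈ fixedCochain k A M H n ∧ deltaCochain ρ n f = 0 := by
  rw [invCochain_eq_fixedCochain_top]
  exact mem_fixed_top_iff E.sup_zpowers

omit [SMulCommClass A Aᵐᵒᵖ M] hM in
theorem deltaCochain_pow_sub_one_mem [H.Normal] (E : IsDeltaExact k A M H ρ q)
    (hf : f ∈ fixedCochain k A M H n) : (deltaCochain ρ n ^ (q - 1)) f ∈ invCochain k A M G n :=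
  E.mem_invCochain_iff.2 ⟨delta_pow_mem_fixed _ hf, by
    rw [← Module.End.mul_apply, ← pow_succ', Nat.sub_add_cancel E.pos, E.pow_eq_zero hf]⟩

theorem deltaCochain_pow_sub_one_mem_inf [H.Normal] (E : IsDeltaExact k A M H ρ q)
    (hf : f ∈ fixedCocycles k A M H n) :
    (deltaCochain ρ n ^ (q - 1)) f ∈ cocycles k A M n ⊓ invCochain k A M G n :=
  ⟨(deltaCochain_pow_mem_fixedCocycles _ hf).1, E.deltaCochain_pow_sub_one_mem hf.2⟩

theorem boundaries_invCochain [H.Normal] (E : IsDeltaExact k A M H ρ q) (n : ℕ) :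
    boundaries (invCochain k A M G) n = deltaBoundaries k A M H ρ (q - 1) n := by
  cases n with
  | zero => exact (Submodule.map_bot _).symm
  | succ n =>
    ext f
    constructor
    · rintro ⟨t, ht, rfl⟩
      obtain ⟨htH, htρ⟩ := E.mem_invCochain_iff.1 ht
      obtain ⟨s, hs, rfl⟩ := E.exists_pow_eq E.pos htH (by rwa [pow_one])
      exact ⟨d n s, ⟨s, hs, rfl⟩, (d_deltaCochain_pow _ s).symm⟩
    · rintro ⟨_, ⟨t, ht, rfl⟩, rfl⟩
      exact ⟨_, E.deltaCochain_pow_sub_one_mem ht, d_deltaCochain_pow _ t⟩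

theorem exists_torsionCocycle_pow_eq (E : IsDeltaExact k A M H ρ q) (hl : l < q)
    (hf : f ∈ invCochain k A M G n) (hfl : f ∈ deltaBoundaries k A M H ρ l n) :
    ∃ w ∈ torsionCocycles k A M H ρ (q - 1 - l) n, (deltaCochain ρ n ^ (q - 1)) w = f := by
  obtain ⟨y, hy, rfl⟩ := hfl
  have hy₀ : (deltaCochain ρ n ^ (l + 1)) y = 0 := by
    rw [pow_succ', Module.End.mul_apply, (E.mem_invCochain_iff.1 hf).2]
  obtain ⟨w₀, hw₀, rfl⟩ := E.exists_pow_eq hl (boundaries_le_fixedCocycles hy).2 hy₀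
  obtain ⟨w, hw, hww₀⟩ := E.exists_cocycle_pow_eq (Nat.sub_le q (l + 1)) hw₀ hy
  rw [← hww₀] at hy ⊢
  rw [show q - (l + 1) = q - 1 - l by omega] at hy ⊢
  exact ⟨w, ⟨hw, hy⟩, (pow_apply_pow_apply (by omega) w).symm⟩

theorem cup_mem_boundaries_invCochain [H.Normal] (E : IsDeltaExact k A M H ρ q)
    (hf : f ∈ invCochain k A M G n) (hfb : f ∈ boundaries (fixedCochain k A M H) n)
    (hg : g ∈ invCochain k A M G r) (hgb : g ∈ boundaries (fixedCochain k A M H) r) :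
    cup n r f g ∈ boundaries (invCochain k A M G) (n + r) := by
  obtain ⟨w, hw, rfl⟩ := E.exists_torsionCocycle_pow_eq E.pos hf ⟨f, hfb, rfl⟩
  rw [E.boundaries_invCochain]
  exact ⟨cup n r w g, cup_mem_boundaries_fixedCochain_right hw.1 hgb,
    deltaCochain_pow_cup_left _ (hg ρ)⟩

omit [SMulCommClass A Aᵐᵒᵖ M] hM in
theorem deltaCochain_pow_sub_one_mem_deltaBoundaries (E : IsDeltaExact k A M H ρ q)
    {i : ℕ} (hi : i + 2 ≤ q) {w' v : Cochain k A M n}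
    (hw' : w' ∈ fixedCochain k A M H n) (hv : v ∈ invCochain k A M G n)
    (hwv : (deltaCochain ρ n ^ i) w - (deltaCochain ρ n ^ (i + 1)) w' - v ∈
      boundaries (fixedCochain k A M H) n) :
    (deltaCochain ρ n ^ (q - 1)) w ∈ deltaBoundaries k A M H ρ (q - 1 - i) n := by
  refine ⟨_, hwv, ?_⟩
  have hv₀ : (deltaCochain ρ n ^ (q - 1 - i)) v = 0 := by
    rw [← pow_apply_pow_apply (show q - 2 - i + 1 = q - 1 - i by omega), pow_one,
      (E.mem_invCochain_iff.1 hv).2, map_zero]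
  rw [map_sub, map_sub, hv₀, pow_apply_pow_apply (by omega : q - 1 - i + i = q - 1),
    pow_apply_pow_apply (by omega : q - 1 - i + (i + 1) = q), E.pow_eq_zero hw', sub_zero, sub_zero]

theorem exists_sub_mem_boundaries [H.Normal] (E : IsDeltaExact k A M H ρ q) {i : ℕ} (hi : i + 2 ≤ q)
    (hw : w ∈ torsionCocycles k A M H ρ (i + 1) n)
    (hwb : (deltaCochain ρ n ^ (q - 1)) w ∈ deltaBoundaries k A M H ρ (q - 1 - i) n) :
    ∃ w' ∈ fixedCocycles k A M H n, ∃ v ∈ cocycles k A M n ⊓ invCochain k A M G n,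
      (deltaCochain ρ n ^ i) w - (deltaCochain ρ n ^ (i + 1)) w' - v ∈
        boundaries (fixedCochain k A M H) n := by
  obtain ⟨y, hy, hyw⟩ := hwb
  have hyZ := boundaries_le_fixedCocycles hy
  have hwi := deltaCochain_pow_mem_fixedCocycles (ρ := ρ) i hw.1
  have hker : (deltaCochain ρ n ^ (q - 1 - i)) ((deltaCochain ρ n ^ i) w - y) = 0 := by
    rw [map_sub, hyw, pow_apply_pow_apply (show q - 1 - i + i = q - 1 by omega), sub_self]
  obtain ⟨w₀, hw₀, hyw₀⟩ := E.exists_pow_eq (by omega) (Submodule.sub_mem _ hwi hyZ).2 hker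
  rw [show q - (q - 1 - i) = i + 1 by omega] at hyw₀
  have hw₀b : (deltaCochain ρ n ^ (i + 2)) w₀ ∈ boundaries (fixedCochain k A M H) n := by
    rw [← pow_apply_pow_apply (show 1 + (i + 1) = i + 2 by omega), hyw₀, map_sub,
      pow_apply_pow_apply (add_comm 1 i)]
    exact Submodule.sub_mem _ hw.2 (deltaCochain_pow_mem_boundaries 1 hy)
  obtain ⟨w', hw', hww'⟩ := E.exists_cocycle_pow_eq hi hw₀ hw₀b
  have hv : (deltaCochain ρ n ^ i) w - (deltaCochain ρ n ^ (i + 1)) w' - y ∈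
      fixedCocycles k A M H n := Submodule.sub_mem _
    (Submodule.sub_mem _ hwi (deltaCochain_pow_mem_fixedCocycles _ hw')) hyZ
  refine ⟨w', hw', _, ⟨hv.1, E.mem_invCochain_iff.2 ⟨hv.2, ?_⟩⟩, by rwa [sub_sub_cancel]⟩
  rw [sub_right_comm, ← hyw₀, map_sub, ← Module.End.mul_apply, ← Module.End.mul_apply, ← pow_succ',
    hww', sub_self]

end IsDeltaExact

end Invariants

section Bimodules

variable {k : Type*} [Field k] {R V W Z : ℕ → Type*}
  [∀ n, AddCommGroup (R n)] [∀ n, Module k (R n)]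
  [∀ n, AddCommGroup (V n)] [∀ n, Module k (V n)]
  [∀ n, AddCommGroup (W n)] [∀ n, Module k (W n)]
  [∀ n, AddCommGroup (Z n)] [∀ n, Module k (Z n)]
  {P : GradedAction k R V} {Q : GradedAction k R W} {T : GradedAction k R Z}

theorem exists_comp_eq_of_ker_le {U X Y : Type*} [AddCommGroup U] [Module k U]
    [AddCommGroup X] [Module k X] [AddCommGroup Y] [Module k Y] {f : U →ₗ[k] X} {g : U →ₗ[k] Y}
    (hf : Function.Surjective f) (h : LinearMap.ker f ≤ LinearMap.ker g) :
    ∃ γ : X →ₗ[k] Y, γ ∘ₗ f = g := by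
  obtain ⟨s, hs⟩ := LinearMap.exists_rightInverse_of_surjective f (LinearMap.range_eq_top.2 hf)
  refine ⟨g ∘ₗ s, LinearMap.ext fun u => ?_⟩
  have hsu : s (f u) - u ∈ LinearMap.ker f := LinearMap.sub_mem_ker_iff.2 (LinearMap.congr_fun hs _)
  exact LinearMap.sub_mem_ker_iff.1 (h hsu)

theorem exists_equiv_apply_eq_of_ker_eq {U X Y : Type*} [AddCommGroup U] [Module k U]
    [AddCommGroup X] [Module k X] [AddCommGroup Y] [Module k Y] {f : U →ₗ[k] X} {g : U →ₗ[k] Y}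
    (hf : Function.Surjective f) (hg : Function.Surjective g)
    (h : LinearMap.ker f = LinearMap.ker g) : ∃ E : X ≃ₗ[k] Y, ∀ u, E (f u) = g u := by
  obtain ⟨γ, hγ⟩ := exists_comp_eq_of_ker_le hf h.le
  obtain ⟨δ, hδ⟩ := exists_comp_eq_of_ker_le hg h.ge
  refine ⟨LinearEquiv.ofLinearMap γ δ ?_ ?_, LinearMap.congr_fun hγ⟩
  · rw [← LinearMap.cancel_right hg, LinearMap.comp_assoc, hδ, hγ, LinearMap.id_comp]
  · rw [← LinearMap.cancel_right hf, LinearMap.comp_assoc, hγ, hδ, LinearMap.id_comp]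

namespace GradedAction

namespace Iso

/-- The inverse of an isomorphism of graded bimodules. -/
def symm (φ : P.Iso Q) : Q.Iso P where
  equiv n := (φ.equiv n).symm
  map_left m n b x := by
    rw [LinearEquiv.symm_apply_eq, φ.map_left, LinearEquiv.apply_symm_apply]
  map_right m n b x := by
    rw [LinearEquiv.symm_apply_eq, φ.map_right, LinearEquiv.apply_symm_apply]

/-- The composition of isomorphisms of graded bimodules. -/
def trans (φ : P.Iso Q) (ψ : Q.Iso T) : P.Iso T where
  equiv n := φ.equiv n ≪≫ₗ ψ.equiv n
  map_left m n b x := by simp only [LinearEquiv.trans_apply, φ.map_left, ψ.map_left]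
  map_right m n b x := by simp only [LinearEquiv.trans_apply, φ.map_right, ψ.map_right]

/-- The isomorphism between two graded bimodules that are zero. -/
def ofSubsingleton [∀ n, Subsingleton (V n)] [∀ n, Subsingleton (W n)] : P.Iso Q where
  equiv _ := 0
  map_left _ _ _ _ := Subsingleton.elim _ _
  map_right _ _ _ _ := Subsingleton.elim _ _

/-- The isomorphism of `V` with its subquotient `V / 0`. -/
noncomputable def quotient {S S' : ∀ n, Submodule k (V n)} (hS : P.IsSubbimodule S)
    (hS' : P.IsSubbimodule S') (h : ∀ n, S n = ⊤) (h' : ∀ n, S' n = ⊥) :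
    P.Iso (P.quotient hS hS') where
  equiv n := LinearEquiv.ofBijective
    (Subquot.mk (S n) (S' n) ∘ₗ LinearMap.id.codRestrict (S n) fun v => h n ▸ Submodule.mem_top)
    ⟨fun v w hvw => by simpa [h', sub_eq_zero] using Subquot.mk_eq_mk.1 hvw,
      (Subquot.mk_surjective _ _).comp fun v => ⟨v, rfl⟩⟩
  map_left _ _ _ _ := rfl
  map_right _ _ _ _ := rfl

theorem nonempty_of_ker_eq (f : ∀ n, Z n →ₗ[k] V n) (g : ∀ n, Z n →ₗ[k] W n)
    (hf : ∀ n, Function.Surjective (f n)) (hg : ∀ n, Function.Surjective (g n))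
    (hfg : ∀ n, LinearMap.ker (f n) = LinearMap.ker (g n))
    (hleft : ∀ m n (b : R m) (z : Z n), ∃ z', f (m + n) z' = P.left m n b (f n z) ∧
      g (m + n) z' = Q.left m n b (g n z))
    (hright : ∀ m n (b : R m) (z : Z n), ∃ z', f (n + m) z' = P.right m n b (f n z) ∧
      g (n + m) z' = Q.right m n b (g n z)) : Nonempty (P.Iso Q) := by
  choose E hE using fun n => exists_equiv_apply_eq_of_ker_eq (hf n) (hg n) (hfg n)
  refine ⟨⟨E, fun m n b x => ?_, fun m n b x => ?_⟩⟩ <;> obtain ⟨z, rfl⟩ := hf n x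
  · obtain ⟨z', hfz, hgz⟩ := hleft m n b z
    rw [← hfz, hE, hE, hgz]
  · obtain ⟨z', hfz, hgz⟩ := hright m n b z
    rw [← hfz, hE, hE, hgz]

variable {S S' : ∀ n, Submodule k (V n)} {T T' : ∀ n, Submodule k (W n)}
  {hS : P.IsSubbimodule S} {hS' : P.IsSubbimodule S'}
  {hT : Q.IsSubbimodule T} {hT' : Q.IsSubbimodule T'}

theorem le_iff (φ : (P.quotient hS hS').Iso (Q.quotient hT hT')) {n : ℕ} :
    S n ≤ S' n ↔ T n ≤ T' n := by
  rw [← Subquot.subsingleton_iff, ← Subquot.subsingleton_iff]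
  exact (φ.equiv n).toEquiv.subsingleton_congr

theorem nonempty_quotient_of_range_eq (f : ∀ n, Z n →ₗ[k] V n) (g : ∀ n, Z n →ₗ[k] W n)
    (hf : ∀ n, LinearMap.range (f n) = S n) (hg : ∀ n, LinearMap.range (g n) = T n)
    (hfg : ∀ n z, f n z ∈ S' n ↔ g n z ∈ T' n)
    (hleft : ∀ m n (b : R m) (z : Z n), ∃ z', f (m + n) z' = P.left m n b (f n z) ∧
      g (m + n) z' = Q.left m n b (g n z))
    (hright : ∀ m n (b : R m) (z : Z n), ∃ z', f (n + m) z' = P.right m n b (f n z) ∧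
      g (n + m) z' = Q.right m n b (g n z)) :
    Nonempty ((P.quotient hS hS').Iso (Q.quotient hT hT')) := by
  obtain rfl : (fun n => LinearMap.range (f n)) = S := funext hf
  obtain rfl : (fun n => LinearMap.range (g n)) = T := funext hg
  refine nonempty_of_ker_eq (fun n => Subquot.mk _ _ ∘ₗ (f n).rangeRestrict)
    (fun n => Subquot.mk _ _ ∘ₗ (g n).rangeRestrict)
    (fun n => (Subquot.mk_surjective _ _).comp (f n).surjective_rangeRestrict)
    (fun n => (Subquot.mk_surjective _ _).comp (g n).surjective_rangeRestrict) (fun n => ?_)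
    (fun m n b z => ?_) (fun m n b z => ?_)
  · ext z
    exact (Subquot.mk_eq_zero _).trans
      ((hfg n z).trans (Subquot.mk_eq_zero ((g n).rangeRestrict z)).symm)
  · obtain ⟨z', hfz, hgz⟩ := hleft m n b z
    exact ⟨z', congrArg (Subquot.mk _ _) (Subtype.ext hfz),
      congrArg (Subquot.mk _ _) (Subtype.ext hgz)⟩
  · obtain ⟨z', hfz, hgz⟩ := hright m n b z
    exact ⟨z', congrArg (Subquot.mk _ _) (Subtype.ext hfz),
      congrArg (Subquot.mk _ _) (Subtype.ext hgz)⟩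

end Iso

end GradedAction

end Bimodules

section KerAction

variable {k A M G : Type*} [Field k] [Ring A] [Algebra k A] [Ring M] [Algebra k M]
  [Module A M] [Module Aᵐᵒᵖ M] [SMulCommClass A Aᵐᵒᵖ M]
  [IsScalarTower k A M] [IsScalarTower k Aᵐᵒᵖ M]
  [Group G] [MulSemiringAction G A] [SMulCommClass G k A]
  [MulSemiringAction G M] [SMulCommClass G k M] [hM : IsAeGModuleAlgebra k A M G]

variable (k A M G) in
theorem exists_isKerAction
    (hX : ∀ n m (x : kerTheta k A M G n) (y : kerTheta k A M G m), cupUp k A M G n m x y = 0) :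
    ∃ P : GradedAction k (fun n => imTheta k A M G n) (fun n => kerTheta k A M G n),
      IsKerAction k A M G P := by
  let L m n := ((cupUp k A M G m n).compl₂ (kerTheta k A M G n).subtype).codRestrict₂
    (kerTheta k A M G (m + n)).subtype Subtype.val_injective fun b x =>
      ⟨⟨cupUp k A M G m n b x, by
        rw [kerTheta, LinearMap.mem_ker, Theta_cupUp, LinearMap.mem_ker.1 x.2, map_zero]⟩, rfl⟩
  let R m n := ((cupUp k A M G n m).flip.compl₂ (kerTheta k A M G n).subtype).codRestrict₂
    (kerTheta k A M G (n + m)).subtype Subtype.val_injective fun b x =>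
      ⟨⟨cupUp k A M G n m x b, by
        rw [kerTheta, LinearMap.mem_ker, Theta_cupUp, LinearMap.mem_ker.1 x.2, map_zero,
          LinearMap.zero_apply]⟩, rfl⟩
  have hL m n b x : (L m n b x : HHup k A M G (m + n)) = cupUp k A M G m n b x :=
    LinearMap.codRestrict₂_apply _ (kerTheta k A M G (m + n)).subtype _ _ b x
  have hR m n b x : (R m n b x : HHup k A M G (n + m)) = cupUp k A M G n m x b :=
    LinearMap.codRestrict₂_apply _ (kerTheta k A M G (n + m)).subtype _ _ b x
  have hker {n} {b : HHup k A M G n} (hb : toImTheta k A M G n b = 0) : b ∈ kerTheta k A M G n :=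
    congrArg Subtype.val hb
  have hsurj n : Function.Surjective (toImTheta k A M G n) := LinearMap.surjective_rangeRestrict _
  choose l hl using fun m n => exists_comp_eq_of_ker_le (hsurj m) (g := L m n) fun b hb =>
    LinearMap.ext fun x => Subtype.ext ((hL m n b x).trans (hX m n ⟨b, hker hb⟩ x))
  choose r hr using fun m n => exists_comp_eq_of_ker_le (hsurj m) (g := R m n) fun b hb =>
    LinearMap.ext fun x => Subtype.ext ((hR m n b x).trans (hX n m x ⟨b, hker hb⟩))
  refine ⟨⟨l, r⟩, fun m n b x => ⟨?_, ?_⟩⟩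
  · rw [← hL, ← hl]
    rfl
  · rw [← hR, ← hr]
    rfl

end KerAction

namespace Subquot

variable {k V : Type*} [Field k] [AddCommGroup V] [Module k V] {P P' U U' : Submodule k V} {v : P}

variable (P P' U) in
/-- The image `(U ∩ P + P') / P'` of a submodule `U` in a subquotient `P / P'`. -/
def image : Submodule k (Subquot P P') := (U.submoduleOf P).map (mk P P')

theorem image_mono (h : U ≤ U') : image P P' U ≤ image P P' U' :=
  Submodule.map_mono (Submodule.comap_mono h)

theorem mk_mem_image_iff (h : P' ≤ P) : mk P P' v ∈ image P P' U ↔ (v : V) ∈ U ⊔ P' := by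
  rw [Submodule.mem_sup]
  constructor
  · rintro ⟨u, hu, huv⟩
    exact ⟨u, hu, v - u, mk_eq_mk.1 huv.symm, add_sub_cancel _ _⟩
  · rintro ⟨u, hu, z, hz, huz⟩
    refine ⟨⟨u, ?_⟩, hu, mk_eq_mk.2 ?_⟩
    · exact add_sub_cancel_right u z ▸ P.sub_mem (huz ▸ v.2) (h hz)
    · exact P'.neg_mem_iff.1 (neg_sub u (v : V) ▸ sub_eq_of_eq_add' huz.symm ▸ hz)

theorem mk_mem_image_iff_of_le (h : P' ≤ U) : mk P P' v ∈ image P P' U ↔ (v : V) ∈ U := by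
  refine ⟨?_, fun hv => ⟨v, hv, rfl⟩⟩
  rintro ⟨u, hu, huv⟩
  exact (U.sub_mem_iff_right hu).1 (h (mk_eq_mk.1 huv))

end Subquot

section Cohomology

variable {k A M G : Type*} [Field k] [Ring A] [Algebra k A] [Ring M] [Algebra k M]
  [Module A M] [Module Aᵐᵒᵖ M] [SMulCommClass A Aᵐᵒᵖ M]
  [IsScalarTower k A M] [IsScalarTower k Aᵐᵒᵖ M]
  [Group G] [MulSemiringAction G A] [SMulCommClass G k A]
  [MulSemiringAction G M] [SMulCommClass G k M] [hM : IsAeGModuleAlgebra k A M G]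
  {H : Subgroup G} {ρ : G} {n r : ℕ}

variable (k A M G n) in
/-- `HH^n(A, M)` as a representation of `G`. -/
def cohomologyRep : Representation k G (HH k A M n) where
  toFun g := actHH k A M G g n
  map_one' := by
    ext x
    obtain ⟨f, rfl⟩ := Subquot.mk_surjective _ _ x
    exact congrArg (Subquot.mk _ _) (Subtype.ext
      (LinearMap.congr_fun (map_one (cochainRep k A M G n)) f.1))
  map_mul' g g' := by
    ext x
    obtain ⟨f, rfl⟩ := Subquot.mk_surjective _ _ x
    exact congrArg (Subquot.mk _ _) (Subtype.ext
      (LinearMap.congr_fun (map_mul (cochainRep k A M G n) g g') f.1))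

theorem invHH_eq_fixed : invHH k A M G H n = fixed (cohomologyRep k A M G n) H :=
  Submodule.ext fun _ => (mem_fixed_iff (τ := cohomologyRep k A M G n)).symm

theorem invHH_top_le : invHH k A M G ⊤ n ≤ invHH k A M G H n :=
  fun _ hx g _ => hx g trivial

theorem DeltaHH_pow_mem_invHH [H.Normal] (j : ℕ) {x : HH k A M n} (hx : x ∈ invHH k A M G H n) :
    (DeltaHH k A M G ρ n ^ j) x ∈ invHH k A M G H n := by
  rw [invHH_eq_fixed] at hx ⊢
  exact delta_pow_mem_fixed j hx

theorem cupHH_mem_invHH_of_mem {x : HH k A M n} {y : HH k A M r} (hx : x ∈ invHH k A M G H n)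
    (hy : y ∈ invHH k A M G H r) : cupHH k A M G n r x y ∈ invHH k A M G H (n + r) :=
  fun g hg => by rw [actHH_cupHH, hx g hg, hy g hg]

theorem DeltaHH_pow_cupHH_left (j : ℕ) {x : HH k A M n} {y : HH k A M r}
    (hy : actHH k A M G ρ r y = y) : (DeltaHH k A M G ρ (n + r) ^ j) (cupHH k A M G n r x y) =
      cupHH k A M G n r ((DeltaHH k A M G ρ n ^ j) x) y :=
  (map_delta_pow (φ := (cupHH k A M G n r).flip y) (τ := cohomologyRep k A M G n)
    (σ := cohomologyRep k A M G (n + r))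
    (fun z => ((actHH_cupHH k A M G ρ n r z y).trans (by rw [hy]; rfl)).symm) j x).symm

theorem DeltaHH_pow_cupHH_right (j : ℕ) {x : HH k A M n} {y : HH k A M r}
    (hx : actHH k A M G ρ n x = x) : (DeltaHH k A M G ρ (n + r) ^ j) (cupHH k A M G n r x y) =
      cupHH k A M G n r x ((DeltaHH k A M G ρ r ^ j) y) :=
  (map_delta_pow (φ := cupHH k A M G n r x) (τ := cohomologyRep k A M G r)
    (σ := cohomologyRep k A M G (n + r))
    (fun z => ((actHH_cupHH k A M G ρ n r x z).trans (by rw [hx]; rfl)).symm) j y).symm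

end Cohomology

section Classes

variable {k A M G : Type*} [Field k] [Ring A] [Algebra k A] [Ring M] [Algebra k M]
  [Module A M] [Module Aᵐᵒᵖ M] [IsScalarTower k A M] [IsScalarTower k Aᵐᵒᵖ M]
  [Group G] [MulSemiringAction G A] [SMulCommClass G k A]
  [MulSemiringAction G M] [SMulCommClass G k M]
  {H : Subgroup G} {ρ : G} {q n r : ℕ}

variable (k A M H n) in
/-- The map sending a cocycle of `C(A, M)^H` to its class in `HH^n(A, M)`. -/
noncomputable def toHH : fixedCocycles k A M H n →ₗ[k] HH k A M n :=
  Subquot.mk _ _ ∘ₗ Submodule.inclusion inf_le_left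

variable (k A M G n) in
/-- The map sending a cocycle of `C(A, M)^G` to its class in `HH^n(A, M)^{G↑}`. -/
def toHHup : ↥(cocycles k A M n ⊓ invCochain k A M G n) →ₗ[k] HHup k A M G n :=
  Subquot.mk _ _

theorem toHHup_surjective : Function.Surjective (toHHup k A M G n) := Subquot.mk_surjective _ _

theorem inf_invCochain_le_fixedCocycles :
    cocycles k A M n ⊓ invCochain k A M G n ≤ fixedCocycles k A M H n :=
  inf_le_inf_left _ (invCochain_le_fixedCochain H n)

theorem exists_toImTheta_toHHup_eq (b : imTheta k A M G n) :
    ∃ v, toImTheta k A M G n (toHHup k A M G n v) = b :=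
  ((LinearMap.surjective_rangeRestrict _).comp toHHup_surjective) b

variable [SMulCommClass A Aᵐᵒᵖ M] [hM : IsAeGModuleAlgebra k A M G]

theorem toHH_eq_zero_iff (hH : (Nat.card H : k) ≠ 0) {w : fixedCocycles k A M H n} :
    toHH k A M H n w = 0 ↔ (w : Cochain k A M n) ∈ boundaries (fixedCochain k A M H) n :=
  (Subquot.mk_eq_zero _).trans
    ⟨mem_boundaries_fixedCochain hH w.2.2, fun h => boundaries_mono (fun _ => le_top) n h⟩

theorem range_toHH (hH : (Nat.card H : k) ≠ 0) :
    LinearMap.range (toHH k A M H n) = invHH k A M G H n := by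
  refine le_antisymm ?_ fun x hx => ?_
  · rintro _ ⟨w, rfl⟩ g hg
    exact congrArg (Subquot.mk _ _) (Subtype.ext (mem_fixed_iff.1 w.2.2 g hg))
  · obtain ⟨f, rfl⟩ := Subquot.mk_surjective _ _ x
    obtain ⟨w, hw, hwf⟩ := exists_mem_fixed_sub_mem (τ := cochainRep k A M G n) (v := f.1) hH
      fun g hg => Subquot.mk_eq_mk.1 (hx g hg)
    have hwc : w ∈ cocycles k A M n := by
      rw [← sub_add_cancel w f]
      exact Submodule.add_mem _ (boundaries_le_cocycles hwf) f.2
    exact ⟨⟨w, hwc, hw⟩, Subquot.mk_eq_mk.2 hwf⟩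

theorem DeltaHH_pow_toHH [H.Normal] (j : ℕ) (w : fixedCocycles k A M H n) :
    (DeltaHH k A M G ρ n ^ j) (toHH k A M H n w) = toHH k A M H n
      ⟨(deltaCochain ρ n ^ j) w, deltaCochain_pow_mem_fixedCocycles j w.2⟩ := by
  have hΔ : ∀ w ∈ fixedCocycles k A M H n, deltaCochain ρ n w ∈ fixedCocycles k A M H n :=
    fun w hw => deltaCochain_pow_mem_fixedCocycles 1 hw
  rw [← map_pow_apply (φ := toHH k A M H n) (S := (deltaCochain ρ n).restrict hΔ)
    (T := DeltaHH k A M G ρ n) (fun _ => rfl) j w, Module.End.pow_restrict]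
  rfl

theorem toHH_mem_imTheta_iff (hH : (Nat.card H : k) ≠ 0) {w : fixedCocycles k A M H n} :
    toHH k A M H n w ∈ imTheta k A M G n ↔ ∃ v ∈ cocycles k A M n ⊓ invCochain k A M G n,
      (w - v : Cochain k A M n) ∈ boundaries (fixedCochain k A M H) n := by
  have hΘ (v : ↥(cocycles k A M n ⊓ invCochain k A M G n)) :
      Theta k A M G n (toHHup k A M G n v) = toHH k A M H n w ↔
        (w - v : Cochain k A M n) ∈ boundaries (fixedCochain k A M H) n := by
    change toHH k A M H n (Submodule.inclusion inf_invCochain_le_fixedCocycles v) = _ ↔ _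
    rw [eq_comm, ← sub_eq_zero, ← map_sub, toHH_eq_zero_iff hH]
    rfl
  constructor
  · rintro ⟨x, hx⟩
    obtain ⟨v, rfl⟩ := toHHup_surjective x
    exact ⟨v, v.2, (hΘ v).1 hx⟩
  · rintro ⟨v, hv, hwv⟩
    exact ⟨toHHup k A M G n ⟨v, hv⟩, (hΘ ⟨v, hv⟩).2 hwv⟩

theorem toHHup_mem_kerTheta_iff (hH : (Nat.card H : k) ≠ 0)
    {v : ↥(cocycles k A M n ⊓ invCochain k A M G n)} : toHHup k A M G n v ∈ kerTheta k A M G n ↔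
      (v : Cochain k A M n) ∈ boundaries (fixedCochain k A M H) n :=
  toHH_eq_zero_iff hH (w := Submodule.inclusion inf_invCochain_le_fixedCocycles v)

namespace IsDeltaExact

theorem toHH_mem_invHH_top_iff [H.Normal] (E : IsDeltaExact k A M H ρ q)
    (hH : (Nat.card H : k) ≠ 0) {w : fixedCocycles k A M H n} :
    toHH k A M H n w ∈ invHH k A M G ⊤ n ↔
      deltaCochain ρ n w ∈ boundaries (fixedCochain k A M H) n := by
  rw [invHH_eq_fixed, mem_fixed_top_iff E.sup_zpowers, ← invHH_eq_fixed, ← range_toHH hH]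
  exact (and_iff_right ⟨w, rfl⟩).trans (toHH_eq_zero_iff hH
    (w := ⟨_, deltaCochain_pow_mem_fixedCocycles 1 w.2⟩))

theorem toHH_deltaCochain_pow_mem_invHH_top_iff [H.Normal] (E : IsDeltaExact k A M H ρ q)
    (hH : (Nat.card H : k) ≠ 0) {w : fixedCocycles k A M H n} {i : ℕ} :
    toHH k A M H n ⟨(deltaCochain ρ n ^ i) w, deltaCochain_pow_mem_fixedCocycles i w.2⟩ ∈
      invHH k A M G ⊤ n ↔ (w : Cochain k A M n) ∈ torsionCocycles k A M H ρ (i + 1) n := by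
  rw [E.toHH_mem_invHH_top_iff hH, ← Module.End.mul_apply, ← pow_succ']
  exact (and_iff_right w.2).symm

theorem cupUp_kerTheta [H.Normal] (E : IsDeltaExact k A M H ρ q) (hH : (Nat.card H : k) ≠ 0)
    (n r : ℕ) (x : kerTheta k A M G n) (y : kerTheta k A M G r) : cupUp k A M G n r x y = 0 := by
  obtain ⟨x, hx⟩ := x
  obtain ⟨y, hy⟩ := y
  obtain ⟨f, rfl⟩ := toHHup_surjective x
  obtain ⟨g, rfl⟩ := toHHup_surjective y
  exact (Subquot.mk_eq_zero _).2 (E.cup_mem_boundaries_invCochain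
    f.2.2 ((toHHup_mem_kerTheta_iff hH).1 hx) g.2.2 ((toHHup_mem_kerTheta_iff hH).1 hy))

end IsDeltaExact

end Classes

section Filtrations

variable {k A M G : Type*} [Field k] [Ring A] [Algebra k A] [Ring M] [Algebra k M]
  [Module A M] [Module Aᵐᵒᵖ M] [SMulCommClass A Aᵐᵒᵖ M]
  [IsScalarTower k A M] [IsScalarTower k Aᵐᵒᵖ M]
  [Group G] [MulSemiringAction G A] [SMulCommClass G k A]
  [MulSemiringAction G M] [SMulCommClass G k M] [hM : IsAeGModuleAlgebra k A M G]
  {H : Subgroup G} {ρ : G} {q i l n : ℕ}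
  {P : GradedAction k (fun n => imTheta k A M G n) (fun n => kerTheta k A M G n)}

variable (k A M H ρ l n) in
/-- The filtration of `X = Ker Θ` by the classes of the elements of `Δ_ρ^l B^n(C(A, M)^H)`. -/
noncomputable def kerFiltration : Submodule k (kerTheta k A M G n) :=
  (Subquot.image _ _ (deltaBoundaries k A M H ρ l n)).submoduleOf (kerTheta k A M G n)

variable (k A M H ρ i n) in
/-- The filtration of `Y = Coker Θ` induced by the submodules `Δ_ρ^i HH^n(A, M)^H`. -/
def cokerFiltration : Submodule k (cokerTheta k A M G n) :=
  Subquot.image _ _ ((invHH k A M G H n).map (DeltaHH k A M G ρ n ^ i))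

theorem antitone_kerFiltration [H.Normal] (n : ℕ) : Antitone fun l => kerFiltration k A M H ρ l n :=
  fun _ _ h => Submodule.comap_mono (Subquot.image_mono (antitone_deltaBoundaries n h))

theorem antitone_cokerFiltration [H.Normal] (n : ℕ) :
    Antitone fun i => cokerFiltration k A M H ρ i n := by
  refine antitone_nat_of_succ_le fun i => Subquot.image_mono ?_
  rintro _ ⟨y, hy, rfl⟩
  exact ⟨_, DeltaHH_pow_mem_invHH 1 hy, pow_apply_pow_apply rfl y⟩

theorem kerFiltration_zero (hH : (Nat.card H : k) ≠ 0) : kerFiltration k A M H ρ 0 n = ⊤ := by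
  rw [eq_top_iff]
  rintro ⟨x, hx⟩ -
  obtain ⟨v, rfl⟩ := Subquot.mk_surjective _ _ x
  exact ⟨v, ⟨v, (toHHup_mem_kerTheta_iff hH).1 hx, rfl⟩, rfl⟩

theorem cokerFiltration_zero : cokerFiltration k A M H ρ 0 n = ⊤ := by
  rw [eq_top_iff]
  rintro x -
  obtain ⟨y, rfl⟩ := Subquot.mk_surjective _ _ x
  exact ⟨y, ⟨y, invHH_top_le y.2, rfl⟩, rfl⟩

theorem isSubbimodule_kerFiltration (hP : IsKerAction k A M G P) :
    P.IsSubbimodule (kerFiltration k A M H ρ l) := by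
  rintro r n b ⟨_, hx⟩ ⟨f, hf, rfl⟩
  obtain ⟨v, rfl⟩ := exists_toImTheta_toHHup_eq b
  constructor
  · rw [kerFiltration, Submodule.submoduleOf, Submodule.mem_comap, Submodule.subtype_apply,
      (hP r n _ _).1]
    exact ⟨_, cup_mem_deltaBoundaries_right v.2 hf, rfl⟩
  · rw [kerFiltration, Submodule.submoduleOf, Submodule.mem_comap, Submodule.subtype_apply,
      (hP r n _ _).2]
    exact ⟨_, cup_mem_deltaBoundaries_left hf v.2, rfl⟩

theorem isSubbimodule_cokerFiltration :
    (cokerAction k A M G).IsSubbimodule (cokerFiltration k A M H ρ i) := by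
  rintro r n b _ ⟨⟨_, hf⟩, ⟨y, hy, rfl⟩, rfl⟩
  have hb := imTheta_le_invHH k A M G r b.2
  constructor
  · exact ⟨_, ⟨cupHH k A M G r n b y, cupHH_mem_invHH_of_mem (invHH_top_le hb) hy,
      DeltaHH_pow_cupHH_right i (hb ρ trivial)⟩, rfl⟩
  · exact ⟨_, ⟨cupHH k A M G n r y b, cupHH_mem_invHH_of_mem hy (invHH_top_le hb),
      DeltaHH_pow_cupHH_left i (hb ρ trivial)⟩, rfl⟩

theorem mk_toHH_mem_cokerFiltration_iff [H.Normal] (hH : (Nat.card H : k) ≠ 0)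
    {w : fixedCocycles k A M H n} (hw : toHH k A M H n w ∈ invHH k A M G ⊤ n) :
    Subquot.mk _ (imTheta k A M G n) ⟨toHH k A M H n w, hw⟩ ∈ cokerFiltration k A M H ρ i n ↔
      ∃ w' ∈ fixedCocycles k A M H n, ∃ v ∈ cocycles k A M n ⊓ invCochain k A M G n,
        (w : Cochain k A M n) - (deltaCochain ρ n ^ i) w' - v ∈
          boundaries (fixedCochain k A M H) n := by
  rw [cokerFiltration, Subquot.mk_mem_image_iff (imTheta_le_invHH k A M G n), ← range_toHH hH,
    Submodule.mem_sup]
  constructor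
  · rintro ⟨_, ⟨_, ⟨w', rfl⟩, rfl⟩, z, hz, hwz⟩
    rw [DeltaHH_pow_toHH, ← eq_sub_iff_add_eq', ← map_sub] at hwz
    exact ⟨w', w'.2, (toHH_mem_imTheta_iff hH).1 (hwz ▸ hz)⟩
  · rintro ⟨w', hw', hv⟩
    refine ⟨_, ⟨_, ⟨⟨w', hw'⟩, rfl⟩, rfl⟩, _, (toHH_mem_imTheta_iff hH
      (w := w - ⟨_, deltaCochain_pow_mem_fixedCocycles i hw'⟩)).2 hv, ?_⟩
    rw [DeltaHH_pow_toHH, ← map_add]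
    exact congrArg _ (add_sub_cancel _ w)

namespace IsDeltaExact

variable [H.Normal]

theorem mk_mem_kerFiltration_iff (E : IsDeltaExact k A M H ρ q) (hl : l < q)
    {v : ↥(cocycles k A M n ⊓ invCochain k A M G n)}
    (hv : toHHup k A M G n v ∈ kerTheta k A M G n) :
    ⟨toHHup k A M G n v, hv⟩ ∈ kerFiltration k A M H ρ l n ↔
      (v : Cochain k A M n) ∈ deltaBoundaries k A M H ρ l n := by
  refine Subquot.mk_mem_image_iff_of_le ?_
  rw [E.boundaries_invCochain]
  exact antitone_deltaBoundaries n (Nat.le_sub_one_of_lt hl)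

theorem kerFiltration_last (E : IsDeltaExact k A M H ρ q) :
    kerFiltration k A M H ρ (q - 1) n = ⊥ := by
  rw [eq_bot_iff]
  rintro ⟨x, hx⟩ hxl
  obtain ⟨v, rfl⟩ := toHHup_surjective x
  rw [E.mk_mem_kerFiltration_iff (Nat.sub_one_lt E.pos.ne') hx, ← E.boundaries_invCochain] at hxl
  exact Subtype.ext ((Subquot.mk_eq_zero v).2 hxl)

theorem cokerFiltration_last (E : IsDeltaExact k A M H ρ q) (hH : (Nat.card H : k) ≠ 0) :
    cokerFiltration k A M H ρ (q - 1) n = ⊥ := by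
  rw [eq_bot_iff]
  rintro _ ⟨⟨_, hf⟩, ⟨y, hy, rfl⟩, rfl⟩
  obtain ⟨w, rfl⟩ := (range_toHH hH).ge hy
  refine (Subquot.mk_eq_zero _).2 ?_
  rw [Submodule.coe_mk, DeltaHH_pow_toHH, toHH_mem_imTheta_iff hH]
  refine ⟨_, E.deltaCochain_pow_sub_one_mem_inf w.2, ?_⟩
  rw [Submodule.coe_mk, sub_self]
  exact Submodule.zero_mem _

/-- The map `w ↦ [Δ_ρ^{q-1} w]` to `X = Ker Θ` on the cocycles whose class is killed by
`Δ_ρ^{i+1}`. -/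
noncomputable def torsionToKer (E : IsDeltaExact k A M H ρ q) (hH : (Nat.card H : k) ≠ 0)
    (hi : i + 2 ≤ q) (n : ℕ) : torsionCocycles k A M H ρ (i + 1) n →ₗ[k] kerTheta k A M G n :=
  (toHHup k A M G n ∘ₗ (deltaCochain ρ n ^ (q - 1)).restrict
    fun w (hw : w ∈ torsionCocycles k A M H ρ (i + 1) n) =>
      E.deltaCochain_pow_sub_one_mem_inf hw.1).codRestrict _
    fun w => (toHHup_mem_kerTheta_iff hH).2 (deltaCochain_pow_mem_boundaries_of_le (by omega) w.2)

/-- The map `w ↦ [Δ_ρ^i w]` to `Y = Coker Θ` on the cocycles whose class is killed by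
`Δ_ρ^{i+1}`. -/
noncomputable def torsionToCoker (E : IsDeltaExact k A M H ρ q) (hH : (Nat.card H : k) ≠ 0)
    (i n : ℕ) : torsionCocycles k A M H ρ (i + 1) n →ₗ[k] cokerTheta k A M G n :=
  Subquot.mk (invHH k A M G ⊤ n) (imTheta k A M G n) ∘ₗ LinearMap.codRestrict (invHH k A M G ⊤ n)
    (toHH k A M H n ∘ₗ (deltaCochain ρ n ^ i).restrict
      fun w (hw : w ∈ torsionCocycles k A M H ρ (i + 1) n) =>
        deltaCochain_pow_mem_fixedCocycles i hw.1)
    fun w => (E.toHH_deltaCochain_pow_mem_invHH_top_iff hH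
      (w := (⟨w, w.2.1⟩ : fixedCocycles k A M H n))).2 w.2

theorem range_torsionToKer (E : IsDeltaExact k A M H ρ q) (hH : (Nat.card H : k) ≠ 0)
    (hi : i + 2 ≤ q) :
    LinearMap.range (E.torsionToKer hH hi n) = kerFiltration k A M H ρ (q - 2 - i) n := by
  apply le_antisymm
  · rintro _ ⟨w, rfl⟩
    exact (E.mk_mem_kerFiltration_iff (by omega) _).2 ⟨_, w.2.2, pow_apply_pow_apply (by omega) _⟩
  · rintro ⟨x, hx⟩ hxl
    obtain ⟨v, rfl⟩ := toHHup_surjective x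
    rw [E.mk_mem_kerFiltration_iff (by omega) hx] at hxl
    obtain ⟨w, hw, hwv⟩ := E.exists_torsionCocycle_pow_eq (by omega) v.2.2 hxl
    rw [show q - 1 - (q - 2 - i) = i + 1 by omega] at hw
    exact ⟨⟨w, hw⟩, Subtype.ext (congrArg (toHHup k A M G n) (Subtype.ext hwv))⟩

theorem range_torsionToCoker (E : IsDeltaExact k A M H ρ q) (hH : (Nat.card H : k) ≠ 0) :
    LinearMap.range (E.torsionToCoker hH i n) = cokerFiltration k A M H ρ i n := by
  apply le_antisymm
  · rintro _ ⟨w, rfl⟩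
    exact ⟨_, ⟨_, (range_toHH hH).le ⟨⟨w, w.2.1⟩, rfl⟩, DeltaHH_pow_toHH i _⟩, rfl⟩
  · rintro _ ⟨⟨_, hf⟩, ⟨y, hy, rfl⟩, rfl⟩
    obtain ⟨w, rfl⟩ := (range_toHH hH).ge hy
    have hw := (E.toHH_deltaCochain_pow_mem_invHH_top_iff hH).1 (DeltaHH_pow_toHH i w ▸ hf)
    exact ⟨⟨w, hw⟩, congrArg (Subquot.mk _ _) (Subtype.ext (DeltaHH_pow_toHH i w).symm)⟩

theorem torsionToCoker_mem_iff (E : IsDeltaExact k A M H ρ q) (hH : (Nat.card H : k) ≠ 0)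
    (hi : i + 2 ≤ q) (w : torsionCocycles k A M H ρ (i + 1) n) :
    E.torsionToCoker hH i n w ∈ cokerFiltration k A M H ρ (i + 1) n ↔
      E.torsionToKer hH hi n w ∈ kerFiltration k A M H ρ (q - 1 - i) n := by
  refine (mk_toHH_mem_cokerFiltration_iff hH _).trans
    (Iff.trans ⟨?_, ?_⟩ (E.mk_mem_kerFiltration_iff (by omega) _).symm)
  · rintro ⟨w', hw', v, hv, hwv⟩
    exact E.deltaCochain_pow_sub_one_mem_deltaBoundaries hi hw'.2 hv.2 hwv
  · exact E.exists_sub_mem_boundaries hi w.2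

theorem exists_torsionToCoker_eq_left (E : IsDeltaExact k A M H ρ q) (hH : (Nat.card H : k) ≠ 0)
    (hi : i + 2 ≤ q) (hP : IsKerAction k A M G P) (r n : ℕ) (b : imTheta k A M G r)
    (w : torsionCocycles k A M H ρ (i + 1) n) :
    ∃ w', E.torsionToCoker hH i (r + n) w' =
        (cokerAction k A M G).left r n b (E.torsionToCoker hH i n w) ∧
      E.torsionToKer hH hi (r + n) w' = P.left r n b (E.torsionToKer hH hi n w) := by
  obtain ⟨v, rfl⟩ := exists_toImTheta_toHHup_eq b
  refine ⟨⟨_, cup_mem_torsionCocycles_right v.2 w.2⟩, ?_, Subtype.ext ?_⟩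
  · exact congrArg (Subquot.mk _ _) (Subtype.ext (congrArg (Subquot.mk _ _)
      (Subtype.ext (deltaCochain_pow_cup_right i (v.2.2 ρ)))))
  · rw [(hP r n _ _).1]
    exact congrArg (toHHup k A M G _) (Subtype.ext (deltaCochain_pow_cup_right _ (v.2.2 ρ)))

theorem exists_torsionToCoker_eq_right (E : IsDeltaExact k A M H ρ q) (hH : (Nat.card H : k) ≠ 0)
    (hi : i + 2 ≤ q) (hP : IsKerAction k A M G P) (r n : ℕ) (b : imTheta k A M G r)
    (w : torsionCocycles k A M H ρ (i + 1) n) :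
    ∃ w', E.torsionToCoker hH i (n + r) w' =
        (cokerAction k A M G).right r n b (E.torsionToCoker hH i n w) ∧
      E.torsionToKer hH hi (n + r) w' = P.right r n b (E.torsionToKer hH hi n w) := by
  obtain ⟨v, rfl⟩ := exists_toImTheta_toHHup_eq b
  refine ⟨⟨_, cup_mem_torsionCocycles_left w.2 v.2⟩, ?_, Subtype.ext ?_⟩
  · exact congrArg (Subquot.mk _ _) (Subtype.ext (congrArg (Subquot.mk _ _)
      (Subtype.ext (deltaCochain_pow_cup_left i (v.2.2 ρ)))))
  · rw [(hP r n _ _).2]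
    exact congrArg (toHHup k A M G _) (Subtype.ext (deltaCochain_pow_cup_left _ (v.2.2 ρ)))

theorem nonempty_iso (E : IsDeltaExact k A M H ρ q) (hH : (Nat.card H : k) ≠ 0)
    (hP : IsKerAction k A M G P) (i : ℕ) (hi : i + 2 ≤ q) :
    Nonempty (((cokerAction k A M G).quotient
      (isSubbimodule_cokerFiltration (H := H) (ρ := ρ) (i := i))
      (isSubbimodule_cokerFiltration (H := H) (ρ := ρ) (i := i + 1))).Iso
        (P.quotient (isSubbimodule_kerFiltration (H := H) (ρ := ρ) (l := q - 2 - i) hP)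
          (isSubbimodule_kerFiltration (H := H) (ρ := ρ) (l := q - 1 - i) hP))) :=
  GradedAction.Iso.nonempty_quotient_of_range_eq
    (Z := fun n => torsionCocycles k A M H ρ (i + 1) n)
    (E.torsionToCoker hH i) (E.torsionToKer hH hi)
    (fun _ => E.range_torsionToCoker hH) (fun _ => E.range_torsionToKer hH hi)
    (fun _ => E.torsionToCoker_mem_iff hH hi) (E.exists_torsionToCoker_eq_left hH hi hP)
    (E.exists_torsionToCoker_eq_right hH hi hP)

end IsDeltaExact

end Filtrations

section Collapse

variable {k A M G : Type*} [Field k] [Ring A] [Algebra k A] [Ring M] [Algebra k M]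
  [Module A M] [Module Aᵐᵒᵖ M] [SMulCommClass A Aᵐᵒᵖ M]
  [IsScalarTower k A M] [IsScalarTower k Aᵐᵒᵖ M]
  [Group G] [MulSemiringAction G A] [SMulCommClass G k A]
  [MulSemiringAction G M] [SMulCommClass G k M] [hM : IsAeGModuleAlgebra k A M G]
  {H : Subgroup G} {ρ : G} {q i l n : ℕ}
  {P : GradedAction k (fun n => imTheta k A M G n) (fun n => kerTheta k A M G n)}

theorem cokerFiltration_eq_top
    (hΔ : (invHH k A M G H n).map (DeltaHH k A M G ρ n ^ i) = invHH k A M G ⊤ n) :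
    cokerFiltration k A M H ρ i n = ⊤ := by
  rw [eq_top_iff, cokerFiltration, hΔ]
  rintro x -
  obtain ⟨y, rfl⟩ := Subquot.mk_surjective _ _ x
  exact ⟨y, y.2, rfl⟩

theorem cokerFiltration_succ_eq_bot
    (hΔ : (invHH k A M G H n).map (DeltaHH k A M G ρ n ^ i) = invHH k A M G ⊤ n) :
    cokerFiltration k A M H ρ (i + 1) n = ⊥ := by
  rw [eq_bot_iff]
  rintro _ ⟨y, ⟨x, hx, hxy⟩, rfl⟩
  have hinv : (DeltaHH k A M G ρ n ^ i) x ∈ invHH k A M G ⊤ n := hΔ ▸ ⟨x, hx, rfl⟩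
  have hy : y = 0 := Subtype.ext <| by
    rw [← Submodule.subtype_apply, ← hxy, pow_succ', Module.End.mul_apply]
    exact sub_eq_zero.2 (hinv ρ trivial).symm
  rw [hy, map_zero]
  exact Submodule.zero_mem _

namespace IsDeltaExact

variable [H.Normal]

theorem kerFiltration_le_iff (E : IsDeltaExact k A M H ρ q) (hH : (Nat.card H : k) ≠ 0)
    (hP : IsKerAction k A M G P) (hi : i + 2 ≤ q) :
    kerFiltration k A M H ρ (q - 2 - i) n ≤ kerFiltration k A M H ρ (q - 1 - i) n ↔
      cokerFiltration k A M H ρ i n ≤ cokerFiltration k A M H ρ (i + 1) n :=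
  ((E.nonempty_iso hH hP i hi).some.le_iff).symm

theorem kerFiltration_eq_bot (E : IsDeltaExact k A M H ρ q) (hH : (Nat.card H : k) ≠ 0)
    (hP : IsKerAction k A M G P) (hi : i ≤ q - 1)
    (htop : cokerFiltration k A M H ρ i n = ⊤) : kerFiltration k A M H ρ (q - 1 - i) n = ⊥ := by
  induction i with
  | zero => exact E.kerFiltration_last
  | succ i ih =>
    have htop' : cokerFiltration k A M H ρ i n = ⊤ :=
      top_le_iff.1 (htop ▸ antitone_cokerFiltration n i.le_succ)
    rw [← le_bot_iff, ← ih (by omega) htop', show q - 1 - (i + 1) = q - 2 - i by omega,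
      E.kerFiltration_le_iff hH hP (by omega), htop]
    exact le_top

theorem kerFiltration_eq_top (E : IsDeltaExact k A M H ρ q) (hH : (Nat.card H : k) ≠ 0)
    (hP : IsKerAction k A M G P) (hl : l ≤ q - 2 - i)
    (hbot : cokerFiltration k A M H ρ (i + 1) n = ⊥) : kerFiltration k A M H ρ l n = ⊤ := by
  induction l with
  | zero => exact kerFiltration_zero hH
  | succ l ih =>
    have hbot' : cokerFiltration k A M H ρ (q - 2 - l) n = ⊥ :=
      le_bot_iff.1 (hbot ▸ antitone_cokerFiltration n (show i + 1 ≤ q - 2 - l by omega))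
    have hle := (E.kerFiltration_le_iff hH hP (i := q - 2 - l) (n := n) (by omega)).2
      (hbot' ▸ bot_le)
    rw [show q - 2 - (q - 2 - l) = l by omega, show q - 1 - (q - 2 - l) = l + 1 by omega,
      ih (by omega)] at hle
    exact top_le_iff.1 hle

theorem nonempty_kerAction_iso_cokerAction (E : IsDeltaExact k A M H ρ q)
    (hH : (Nat.card H : k) ≠ 0) (hP : IsKerAction k A M G P) (hi : i ≤ q - 1)
    (htop : ∀ n, cokerFiltration k A M H ρ i n = ⊤)
    (hbot : ∀ n, cokerFiltration k A M H ρ (i + 1) n = ⊥) :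
    Nonempty (P.Iso (cokerAction k A M G)) := by
  have hXtop (n : ℕ) : kerFiltration k A M H ρ (q - 2 - i) n = ⊤ :=
    E.kerFiltration_eq_top hH hP le_rfl (hbot n)
  have hXbot (n : ℕ) : kerFiltration k A M H ρ (q - 1 - i) n = ⊥ :=
    E.kerFiltration_eq_bot hH hP hi (htop n)
  rcases hi.lt_or_eq with hlt | rfl
  · obtain ⟨φ⟩ := E.nonempty_iso hH hP i (by omega)
    exact ⟨(GradedAction.Iso.quotient _ _ hXtop hXbot).trans
      (φ.symm.trans (GradedAction.Iso.quotient _ _ htop hbot).symm)⟩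
  · have hX (n : ℕ) : Subsingleton (kerTheta k A M G n) := by
      rw [← Submodule.subsingleton_iff k, ← subsingleton_iff_bot_eq_top, ← hXbot n, Nat.sub_self,
        kerFiltration_zero hH]
    have hY (n : ℕ) : Subsingleton (cokerTheta k A M G n) := by
      rw [← Submodule.subsingleton_iff k, ← subsingleton_iff_bot_eq_top, ← htop n,
        E.cokerFiltration_last hH]
    exact ⟨GradedAction.Iso.ofSubsingleton⟩

end IsDeltaExact

end Collapse

section CyclicQuotient

variable {G : Type*} [Group G] {H : Subgroup G} [H.Normal] {ρ : G}

theorem sup_zpowers_eq_top (hρ : ∀ x : G ⧸ H, x ∈ Subgroup.zpowers (ρ : G ⧸ H)) :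
    H ⊔ Subgroup.zpowers ρ = ⊤ := by
  refine eq_top_iff.2 fun g _ => ?_
  obtain ⟨j, hj⟩ := hρ g
  have hg : (ρ ^ j)⁻¹ * g ∈ H := QuotientGroup.eq.1 hj
  rw [sup_comm]
  exact mul_inv_cancel_left (ρ ^ j) g ▸ Subgroup.mul_mem_sup ⟨j, rfl⟩ hg

end CyclicQuotient

end HochG

open HochG in
theorem mainTheorem3 {k A M G : Type*} [Field k] [Ring A] [Algebra k A] [Ring M] [Algebra k M]
    [Module A M] [Module Aᵐᵒᵖ M] [SMulCommClass A Aᵐᵒᵖ M]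
    [IsScalarTower k A M] [IsScalarTower k Aᵐᵒᵖ M]
    [Group G] [MulSemiringAction G A] [SMulCommClass G k A]
    [MulSemiringAction G M] [SMulCommClass G k M] [IsAeGModuleAlgebra k A M G]
    (p : ℕ) [Fact p.Prime] [CharP k p] (q e : ℕ) (hq : q = p ^ e)
    (H : Subgroup G) [H.Normal] [Finite H] (hH : ¬ p ∣ Nat.card H)
    (hGH : Nat.card (G ⧸ H) = q)
    (ρ : G) (hρ : ∀ x : G ⧸ H, x ∈ Subgroup.zpowers (ρ : G ⧸ H))
    (m : M) (h : A →ₗ[k] M) (hdeg : IsDegenerated H ρ q m h) :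
    ∃ XAct : GradedAction k (fun n => imTheta k A M G n) (fun n => kerTheta k A M G n),
    IsKerAction k A M G XAct ∧
    ∃ (X : ℕ → ∀ n, Submodule k (kerTheta k A M G n))
      (Y : ℕ → ∀ n, Submodule k (cokerTheta k A M G n))
      (hX : ∀ i, XAct.IsSubbimodule (X i))
      (hY : ∀ i, (cokerAction k A M G).IsSubbimodule (Y i)),
    (∀ i n, X (i + 1) n ≤ X i n) ∧ (∀ n, X 0 n = ⊤) ∧ (∀ n, X (q - 1) n = ⊥) ∧
    (∀ i n, Y (i + 1) n ≤ Y i n) ∧ (∀ n, Y 0 n = ⊤) ∧ (∀ n, Y (q - 1) n = ⊥) ∧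
    (∀ i, i + 2 ≤ q →
      Nonempty (((cokerAction k A M G).quotient (hY i) (hY (i + 1))).Iso
        (XAct.quotient (hX (q - 2 - i)) (hX (q - 1 - i))))) ∧
    (∀ i, i ≤ q - 1 →
      (∀ n, (invHH k A M G H n).map (DeltaHH k A M G ρ n ^ i) = invHH k A M G ⊤ n) →
      (∀ n, X (q - 1 - i) n = ⊥ ∧ Y (i + 1) n = ⊥ ∧ X (q - 2 - i) n = ⊤ ∧ Y i n = ⊤) ∧
      Nonempty (XAct.Iso (cokerAction k A M G))) := by
  subst hq
  have hcard : (Nat.card H : k) ≠ 0 := fun h0 => hH ((CharP.cast_eq_zero_iff k p _).1 h0)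
  have E := hdeg.isDeltaExact (sup_zpowers_eq_top hρ) (hGH ▸ H.pow_index_mem ρ)
  obtain ⟨P, hP⟩ := exists_isKerAction k A M G (E.cupUp_kerTheta hcard)
  refine ⟨P, hP, kerFiltration k A M H ρ, cokerFiltration k A M H ρ,
    fun _ => isSubbimodule_kerFiltration hP, fun _ => isSubbimodule_cokerFiltration,
    fun i n => antitone_kerFiltration n i.le_succ, fun _ => kerFiltration_zero hcard,
    fun _ => E.kerFiltration_last, fun i n => antitone_cokerFiltration n i.le_succ,
    fun _ => cokerFiltration_zero, fun _ => E.cokerFiltration_last hcard,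
    E.nonempty_iso hcard hP, fun i hi hΔ => ?_⟩
  have htop n := cokerFiltration_eq_top (hΔ n)
  have hbot n := cokerFiltration_succ_eq_bot (hΔ n)
  exact ⟨fun n => ⟨E.kerFiltration_eq_bot hcard hP hi (htop n), hbot n,
      E.kerFiltration_eq_top hcard hP le_rfl (hbot n), htop n⟩,
    E.nonempty_kerAction_iso_cokerAction hcard hP hi htop hbot⟩
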